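/- **Setting.** Consider an open chain of $N$ qubits with Pauli matrices $\sigma_l^x,\sigma_l^y,\sigma_l^z$ on qubit $l$. Let $n\ge1$, $0=t_0<t_1<\cdots<t_n=1$, $\alpha=(\alpha_j^u)\in\{0,1\}^{3n}$ and $\gamma=(\gamma_j^{u,v})\in\{0,1\}^{9n}$, where $1\le j\le n$ and $u,v\in\{x,y,z\}$. For parameters $\mathbf h=(h_{j,l}^u)\in\mathbb R^{3nN}$ and $\mathbf J=(J_{j,l}^{u,v})\in\mathbb R^{9n(N-1)}$ let $H(t)$ be the Hamiltonian of period $1$ with $$H(t)=H_j:=\sum_{l=1}^N\sum_{u}\alpha_j^u h_{j,l}^u\sigma_l^u+\sum_{l=1}^{N-1}\sum_{u,v}\gamma_j^{u,v}J_{j,l}^{u,v}\sigma_l^u\sigma_{l+1}^v,\qquad t_{j-1}\le t<t_j .$$ Let $U(0,t)=\mathcal T e^{-i\int_0^tH(s)\,\mathrm ds}$ be the evolution operator, i.e. the time-ordered product of the exponentials $e^{-i\tau H_j}$ over the successive pieces of $[0,t]$ on which $H$ is constant, $\tau$ being the length of the piece. The initial state is a Haar-random product state $|\psi(0)\rangle=\bigotimes_{l=1}^N|\phi_l\rangle$: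 the $|\phi_l\rangle$ are independent and uniformly distributed on the unit sphere of $\mathbb C^2$. Put $|\psi(t)\rangle=U(0,t)|\psi(0)\rangle$ for $t\ge0$. For a (not necessarily connected) set $S$ of qubits with complement $\bar S$ let $\psi(t)_S=\operatorname{tr}_{\bar S}|\psi(t)\rangle\langle\psi(t)|$. A function $f$ of time with values in density matrices (positive semidefinite matrices of trace $1$) is called $\epsilon$-periodic (with period $1$) if there is a measurable function $\bar f$ on $[0,1)$ with values in density matrices such that $$\liminf_{M\to\infty}\frac1M\left|\left\{m\in\{0,1,\ldots,M-1\}:\int_0^1\|f(m+x)-\bar f(x)\|_1\,\mathrm dx\le\epsilon\right\}\right|\ge1-\epsilon,$$ where $\|\cdot\|_1$ is the trace norm. **Theorem 3.** There are constants $c_1,c_2>0$ and $N_0$ such that the following holds for all $N>N_0$, all $(n,(t_j),\alpha,\gamma)$ as above with $\alpha_1^x=\alpha_1^z=\gamma_1^{zz}=1$, and all sets $S$ of $L\le0.29248\,N$ qubits. For all $(\mathbf h,\mathbf J)\in\mathbb R^{12nN-9n}$ outside a set of Lebesgue measure zero, the probability over the Haar-random product state $|\psi(0)\rangle$ that $\psi(t)_S$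 is $e^{-c_1N}$-periodic is at least $1-e^{-c_2N}$ (the exceptional set of initial states has outer measure at most $e^{-c_2N}$). -/

import Mathlib

open MeasureTheory Filter
open scoped ComplexOrder

noncomputable section

namespace Floquet

/-! ### Qubits and Pauli matrices -/

/-- The three spin directions. -/
inductive Axis
  | x
  | y
  | z
  deriving DecidableEq

instance : Fintype Axis where
  elems := {Axis.x, Axis.y, Axis.z}
  complete := by intro u; cases u <;> decide

/-- The Pauli matrices of a single qubit. -/
def pauli : Axis → Matrix (Fin 2) (Fin 2) ℂ
  | Axis.x => !![0, 1; 1, 0]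
  | Axis.y => !![0, -Complex.I; Complex.I, 0]
  | Axis.z => !![1, 0; 0, -1]

/-- The computational basis of qubits labelled by `ι`. The Hilbert space of these qubits is the
space of functions `Basis ι → ℂ`, and the operators on it are the square matrices indexed by
`Basis ι`. -/
abbrev Basis (ι : Type) : Type := ι → Fin 2

/-- The operator acting as `M` on qubit `l` and as the identity on all the other qubits. -/
def onSite {N : ℕ} (l : Fin N) (M : Matrix (Fin 2) (Fin 2) ℂ) :
    Matrix (Basis (Fin N)) (Basis (Fin N)) ℂ :=
  Matrix.of fun a b => if ∀ k, k ≠ l → a k = b k then M (a l) (b l) else 0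

/-- The Pauli matrix `σ_l^u` on the chain of `N` qubits. -/
def sigma {N : ℕ} (l : Fin N) (u : Axis) : Matrix (Basis (Fin N)) (Basis (Fin N)) ℂ :=
  onSite l (pauli u)

/-! ### The ensemble of piecewise time-independent Floquet systems -/

/-- The left end of the `l`-th nearest-neighbour bond of the open chain. -/
def bondLeft {N : ℕ} (l : Fin (N - 1)) : Fin N := ⟨l.1, by omega⟩

/-- The right end of the `l`-th nearest-neighbour bond of the open chain. -/
def bondRight {N : ℕ} (l : Fin (N - 1)) : Fin N := ⟨l.1 + 1, by omega⟩

/-- The labels of the real parameters: `(j, l, u)` for the field `h_{j,l}^u` and `(j, l, u, v)`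
for the coupling `J_{j,l}^{u,v}`. For `1 ≤ N` there are `3nN + 9n(N-1) = 12nN - 9n` of them. -/
abbrev ParamIndex (n N : ℕ) : Type :=
  (Fin n × Fin N × Axis) ⊕ (Fin n × Fin (N - 1) × Axis × Axis)

/-- The parameter space of pairs `(h, J)`, with its Lebesgue measure `volume`. -/
abbrev Param (n N : ℕ) : Type := ParamIndex n N → ℝ

/-- The on-site field `h_{j,l}^u`. -/
def field {n N : ℕ} (p : Param n N) (j : Fin n) (l : Fin N) (u : Axis) : ℝ :=
  p (Sum.inl (j, l, u))

/-- The nearest-neighbour coupling `J_{j,l}^{u,v}`. -/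
def coupling {n N : ℕ} (p : Param n N) (j : Fin n) (l : Fin (N - 1)) (u v : Axis) : ℝ :=
  p (Sum.inr (j, l, u, v))

/-- The data `(n, T, α, γ)` of an ensemble: `n ≥ 1` pieces, the switching times
`0 = t_0 < t_1 < ⋯ < t_n = 1`, and the binary indicators `α_j^u`, `γ_j^{u,v}` of the types of
terms that are present in each piece. -/
structure Ensemble where
  n : ℕ
  n_pos : 0 < n
  time : Fin (n + 1) → ℝ
  time_zero : time 0 = 0
  time_last : time (Fin.last n) = 1
  time_strictMono : StrictMono time
  α : Fin n → Axis → Bool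
  γ : Fin n → Axis → Axis → Bool

/-- The first piece of the driving period. -/
def Ensemble.first (E : Ensemble) : Fin E.n := ⟨0, E.n_pos⟩

/-- The Hamiltonian `H_j` of the `j`-th piece, at the parameters `p = (h, J)`. -/
def Ensemble.pieceHamiltonian (E : Ensemble) {N : ℕ} (p : Param E.n N) (j : Fin E.n) :
    Matrix (Basis (Fin N)) (Basis (Fin N)) ℂ :=
  (∑ l : Fin N, ∑ u : Axis,
      (if E.α j u then ((field p j l u : ℝ) : ℂ) else 0) • sigma l u) +
    ∑ l : Fin (N - 1), ∑ u : Axis, ∑ v : Axis,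
      (if E.γ j u v then ((coupling p j l u v : ℝ) : ℂ) else 0) •
        (sigma (bondLeft l) u * sigma (bondRight l) v)

/-! ### Time evolution -/

/-- The time that is spent in the `j`-th piece `[t_{j-1}, t_j)` before the time `x`. -/
def Ensemble.duration (E : Ensemble) (j : Fin E.n) (x : ℝ) : ℝ :=
  max 0 (min x (E.time j.succ) - E.time j.castSucc)

/-- The evolution operator `U(0, x)` for `0 ≤ x ≤ 1`: the time-ordered exponential of the
piecewise constant Hamiltonian, that is, the product of the `exp (-i τ_j H_j)`, later pieces
standing to the left, where `τ_j` is the time spent in piece `j` before `x`. -/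
def Ensemble.evolutionWithin (E : Ensemble) {N : ℕ} (p : Param E.n N) (x : ℝ) :
    Matrix (Basis (Fin N)) (Basis (Fin N)) ℂ :=
  (List.ofFn fun j : Fin E.n =>
    NormedSpace.exp ((-Complex.I * (E.duration j x : ℂ)) • E.pieceHamiltonian p j)).reverse.prod

/-- The Floquet operator `U_F = U(0, 1)`. -/
def Ensemble.floquetOperator (E : Ensemble) {N : ℕ} (p : Param E.n N) :
    Matrix (Basis (Fin N)) (Basis (Fin N)) ℂ :=
  E.evolutionWithin p 1

/-- The evolution operator `U(0, t)` for `t ≥ 0`, the Hamiltonian having period `1`: `⌊t⌋` full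
periods followed by the evolution within one period for the remaining time. -/
def Ensemble.evolution (E : Ensemble) {N : ℕ} (p : Param E.n N) (t : ℝ) :
    Matrix (Basis (Fin N)) (Basis (Fin N)) ℂ :=
  E.evolutionWithin p (Int.fract t) * E.floquetOperator p ^ ⌊t⌋₊

/-- The state `ψ(t) = U(0, t) ψ(0)`. -/
def Ensemble.state (E : Ensemble) {N : ℕ} (p : Param E.n N) (ψ₀ : Basis (Fin N) → ℂ) (t : ℝ) :
    Basis (Fin N) → ℂ :=
  (E.evolution p t).mulVec ψ₀

/-! ### Haar-random product states -/

/-- The pure states of a qubit: the unit sphere of `ℂ²`. -/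
abbrev QubitState : Type := Metric.sphere (0 : EuclideanSpace ℂ (Fin 2)) 1

/-- The Haar (uniform) probability measure on the pure states of a qubit: the surface measure of
the unit sphere of `ℂ²`, normalized. -/
def haarQubit : Measure QubitState :=
  ((volume : Measure (EuclideanSpace ℂ (Fin 2))).toSphere Set.univ)⁻¹ •
    (volume : Measure (EuclideanSpace ℂ (Fin 2))).toSphere

instance : IsProbabilityMeasure haarQubit := by
  unfold haarQubit
  constructor
  rw [Measure.smul_apply, smul_eq_mul]
  refine ENNReal.inv_mul_cancel ?_ (measure_ne_top _ _)
  have : Nonempty QubitState := (NormedSpace.sphere_nonempty.2 zero_le_one).to_subtype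
  exact IsOpen.measure_ne_zero _ isOpen_univ Set.univ_nonempty

/-- The law of the `N` independent Haar-random factors of a Haar-random product state. -/
def haarProduct (N : ℕ) : Measure (Fin N → QubitState) :=
  Measure.pi fun _ => haarQubit

/-- The product state `⊗_l φ_l`. -/
def productState {N : ℕ} (φ : Fin N → QubitState) : Basis (Fin N) → ℂ :=
  fun a => ∏ l, (φ l : EuclideanSpace ℂ (Fin 2)) (a l)

/-! ### Reduced density matrices, trace norm -/

/-- The configuration of all the qubits with values `a` on `S` and `c` on the complement. -/
def merge {N : ℕ} (S : Finset (Fin N)) (a : Basis {k // k ∈ S}) (c : Basis {k // k ∉ S}) :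
    Basis (Fin N) :=
  fun k => if h : k ∈ S then a ⟨k, h⟩ else c ⟨k, h⟩

/-- The partial trace over the complement of `S`. -/
def partialTrace {N : ℕ} (S : Finset (Fin N)) (ρ : Matrix (Basis (Fin N)) (Basis (Fin N)) ℂ) :
    Matrix (Basis {k // k ∈ S}) (Basis {k // k ∈ S}) ℂ :=
  Matrix.of fun a b => ∑ c : Basis {k // k ∉ S}, ρ (merge S a c) (merge S b c)

/-- The reduced density matrix on `S` of the pure state `ψ`, the partial trace of `|ψ⟩⟨ψ|`. -/
def reducedDensity {N : ℕ} (S : Finset (Fin N)) (ψ : Basis (Fin N) → ℂ) :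
    Matrix (Basis {k // k ∈ S}) (Basis {k // k ∈ S}) ℂ :=
  partialTrace S (Matrix.vecMulVec ψ (star ψ))

/-- The density matrices: positive semidefinite with unit trace. -/
def IsDensity {d : Type} [Fintype d] (ρ : Matrix d d ℂ) : Prop :=
  ρ.PosSemidef ∧ ρ.trace = 1

/-- The trace norm: the sum of the singular values, which are the square roots of the
eigenvalues of `Aᴴ A`. -/
def traceNorm {d : Type} [Fintype d] [DecidableEq d] (A : Matrix d d ℂ) : ℝ :=
  ∑ i, √((Matrix.isHermitian_conjTranspose_mul_self A).eigenvalues i)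

/-! ### Approximate periodicity -/

open Classical in
/-- The matrix function `f` is `ε`-periodic with period `1`: there is a (measurable) function
`g`, which takes density matrices as values on `[0, 1)`, such that the lower asymptotic density of
the periods `m` with `∫₀¹ ‖f (m + x) - g x‖₁ dx ≤ ε` is at least `1 - ε`. The integral of the
nonnegative integrand is the Lebesgue integral with values in `[0, ∞]`. -/
def IsApproxPeriodic {d : Type} [Fintype d] [DecidableEq d] (ε : ℝ) (f : ℝ → Matrix d d ℂ) :
    Prop :=
  ∃ g : ℝ → Matrix d d ℂ,
    (∀ a b, Measurable fun x => g x a b) ∧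
    (∀ x ∈ Set.Ico (0 : ℝ) 1, IsDensity (g x)) ∧
    1 - ε ≤ liminf (fun M : ℕ =>
      (((Finset.range M).filter fun m : ℕ =>
          ∫⁻ x in Set.Ico (0 : ℝ) 1, ENNReal.ofReal (traceNorm (f (m + x) - g x)) ≤
            ENNReal.ofReal ε).card : ℝ) / (M : ℝ)) atTop

end Floquet

end

/-! In the eigenbasis of the Floquet operator, with eigenvalues `z j` and initial amplitudes `c j`,
the reduced state at time `m + x` is a profile depending only on `x` (the dephased state) plus
off-diagonal terms oscillating in `m` with the frequencies `z j * star (z k)`, `j ≠ k`. If all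
products `z a * z b` are distinct up to order, these frequencies are distinct, and the mean square
over `m` of each matrix entry becomes a plain sum of squares. A Schur test bounds the sum over all
entries by `2 ^ L * ∑ ‖c j‖ ^ 4`, and passing to the trace norm costs another `2 ^ L`
(`exists_sum_traceNorm_le`). Markov's inequality over the periods then gives approximate periodicity
as soon as `4 ^ L * ∑ ‖c j‖ ^ 4` is exponentially small.

For a Haar-random product state, the fourth moment of the overlap with any unit vector is at most `3
^ (-N)` (`integral_overlap_pow_four_le`), so `∑ ‖c j‖ ^ 4` has mean at most `(2/3) ^ N`. It beats `4
^ L` when `L / N` is below `log₂ (3/2) / 2 = 0.29248…`.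

Genericity of the products is the non-vanishing of a polynomial in the entries of the Floquet
operator, hence of a function that is analytic along lines in parameter space
(`ae_ne_zero_of_analytic_on_lines`). One example therefore settles almost all parameters. The
example is an Ising chain in the first piece and zero Hamiltonian in the others; it is built spin by
spin with first order perturbation theory (`HasGenericSpectrum.exists_extendChain`). The induction
carries along that the last spin's `z`-expectation separates the eigenvectors, since this is what
lets the next coupling lift the remaining degeneracies. -/

/-! ### Perturbation of simple eigenpairs -/

open Topology Matrix in
/-- A simple eigenpair of a real symmetric matrix extends to a differentiable curve of eigenpairs
along a linear perturbation. -/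
theorem Matrix.IsSymm.exists_hasDerivAt_eigenpair {ι : Type*} [Fintype ι] [DecidableEq ι]
    {A : Matrix ι ι ℝ} (hA : A.IsSymm) (B : Matrix ι ι ℝ) {v : ι → ι → ℝ} {e : ι → ℝ}
    (he : Function.Injective e) (hv : ∀ i, A *ᵥ v i = e i • v i) (hvv : ∀ i, v i ⬝ᵥ v i = 1)
    (i : ι) :
    ∃ (x : ℝ → ι → ℝ) (E : ℝ → ℝ) (x' : ι → ℝ) (E' : ℝ),
      HasDerivAt x x' 0 ∧ HasDerivAt E E' 0 ∧ x 0 = v i ∧ E 0 = e i ∧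
      ∀ᶠ t in 𝓝 (0 : ℝ), (A + t • B) *ᵥ x t = E t • x t := by
  have : Nonempty ι := ⟨i⟩
  have hv0 : ∀ k, v k ≠ 0 := fun k h => by simpa [h] using hvv k
  have hli : LinearIndependent ℝ v := by
    refine Module.End.eigenvectors_linearIndependent' (Matrix.mulVecLin A) e he v fun k => ?_
    exact ⟨Module.End.mem_eigenspace_iff.2 (hv k), hv0 k⟩
  let b := basisOfLinearIndependentOfCardEqFinrank hli (by simp)
  let AL : (ι → ℝ) →L[ℝ] (ι → ℝ) := LinearMap.toContinuousLinearMap (Matrix.mulVecLin A)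
  let BL : (ι → ℝ) →L[ℝ] (ι → ℝ) := LinearMap.toContinuousLinearMap (Matrix.mulVecLin B)
  let dL : (ι → ℝ) →L[ℝ] ℝ := LinearMap.toContinuousLinearMap (dotProductBilin ℝ ℝ (v i))
  have hdL : ∀ w, dL w = v i ⬝ᵥ w := fun w => rfl
  -- The implicit function theorem is applied to the eigenvalue equation together with the linear
  -- normalization `v i ⬝ᵥ x = 1`, which makes the number of equations equal to the number of
  -- unknowns `(x, E)`.
  let f : ℝ × ((ι → ℝ) × ℝ) → (ι → ℝ) × ℝ := fun u =>
    (AL u.2.1 + u.1 • BL u.2.1 - u.2.2 • u.2.1, dL u.2.1)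
  let u₀ : ℝ × ((ι → ℝ) × ℝ) := (0, (v i, e i))
  have hf1 : HasStrictFDerivAt (fun u : ℝ × ((ι → ℝ) × ℝ) => u.2.1)
      ((ContinuousLinearMap.fst ℝ (ι → ℝ) ℝ).comp (ContinuousLinearMap.snd ℝ ℝ _)) u₀ :=
    ((ContinuousLinearMap.fst ℝ (ι → ℝ) ℝ).comp
      (ContinuousLinearMap.snd ℝ ℝ _)).hasStrictFDerivAt
  have hf2 : HasStrictFDerivAt (fun u : ℝ × ((ι → ℝ) × ℝ) => u.2.2)
      ((ContinuousLinearMap.snd ℝ (ι → ℝ) ℝ).comp (ContinuousLinearMap.snd ℝ ℝ _)) u₀ :=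
    ((ContinuousLinearMap.snd ℝ (ι → ℝ) ℝ).comp
      (ContinuousLinearMap.snd ℝ ℝ _)).hasStrictFDerivAt
  have hf0 : HasStrictFDerivAt (fun u : ℝ × ((ι → ℝ) × ℝ) => u.1)
      (ContinuousLinearMap.fst ℝ ℝ ((ι → ℝ) × ℝ)) u₀ :=
    (ContinuousLinearMap.fst ℝ ℝ ((ι → ℝ) × ℝ)).hasStrictFDerivAt
  obtain ⟨f', hf, hfw⟩ : ∃ f' : ℝ × ((ι → ℝ) × ℝ) →L[ℝ] (ι → ℝ) × ℝ,
      HasStrictFDerivAt f f' u₀ ∧ ∀ w : (ι → ℝ) × ℝ, (f' ∘L .inr ℝ ℝ ((ι → ℝ) × ℝ)) w =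
        (A *ᵥ w.1 - (e i • w.1 + w.2 • v i), v i ⬝ᵥ w.1) := by
    refine ⟨_, (((AL.hasStrictFDerivAt.comp u₀ hf1).add
      (hf0.smul (BL.hasStrictFDerivAt.comp u₀ hf1))).sub (hf2.smul hf1)).prodMk
      (dL.hasStrictFDerivAt.comp u₀ hf1), fun w => ?_⟩
    simp [u₀, AL, hdL]
  -- Pairing with `v k` diagonalizes the linearized equation. The case `k = i` kills `ε`, simplicity
  -- of `e i` kills the components with `k ≠ i`, and the normalization kills the last one. In finite
  -- dimension injectivity suffices.
  have hker : ∀ w : (ι → ℝ) × ℝ, (f' ∘L .inr ℝ ℝ ((ι → ℝ) × ℝ)) w = 0 → w = 0 := by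
    rintro ⟨w, ε⟩ h
    rw [hfw, Prod.mk_eq_zero] at h
    obtain ⟨h1, h2⟩ := h
    simp only at h1 h2
    have hsym : ∀ k, v k ⬝ᵥ A *ᵥ w = e k * (v k ⬝ᵥ w) := by
      intro k
      rw [Matrix.dotProduct_mulVec, ← Matrix.mulVec_transpose, hA.eq, hv, smul_dotProduct,
        smul_eq_mul]
    have hk : ∀ k, (e k - e i) * (v k ⬝ᵥ w) = ε * (v k ⬝ᵥ v i) := by
      intro k
      have := congrArg (fun y => v k ⬝ᵥ y) h1
      simp only [dotProduct_sub, dotProduct_add, dotProduct_smul, hsym, dotProduct_zero,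
        smul_eq_mul] at this
      linarith
    have hε : ε = 0 := by
      have := hk i
      rw [hvv] at this
      linarith
    have hz : ∀ k, v k ⬝ᵥ w = 0 := by
      intro k
      by_cases hki : k = i
      · rw [hki, h2]
      · have := hk k
        rw [hε, zero_mul] at this
        exact (mul_eq_zero.1 this).resolve_left (sub_ne_zero.2 fun h => hki (he h))
    have hw : w ⬝ᵥ w = 0 := by
      conv_lhs => rw [← b.sum_repr w]
      rw [sum_dotProduct]
      refine Finset.sum_eq_zero fun k _ => ?_
      rw [b.sum_repr w, smul_dotProduct, coe_basisOfLinearIndependentOfCardEqFinrank, hz,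
        smul_zero]
    rw [dotProduct_self_eq_zero.1 hw, hε]
    rfl
  have hinv : (f' ∘L .inr ℝ ℝ ((ι → ℝ) × ℝ)).IsInvertible := by
    have hinj : Function.Injective (f' ∘L .inr ℝ ℝ ((ι → ℝ) × ℝ)).toLinearMap :=
      (injective_iff_map_eq_zero (f' ∘L .inr ℝ ℝ ((ι → ℝ) × ℝ)).toLinearMap).2 hker
    refine ⟨(LinearEquiv.ofInjectiveEndo _ hinj).toContinuousLinearEquiv, ?_⟩
    ext w <;> rfl
  have hd := (hf.hasStrictFDerivAt_implicitFunctionOfProdDomain hinv).hasFDerivAt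
  have hev := hf.eventually_apply_implicitFunctionOfProdDomain hinv
  have h0 : hf.implicitFunctionOfProdDomain hinv 0 = (v i, e i) :=
    eq_of_tendsto_nhds (hf.tendsto_implicitFunctionOfProdDomain hinv)
  set ψ := hf.implicitFunctionOfProdDomain hinv
  have hd' := hd.hasDerivAt
  refine ⟨fun t => (ψ t).1, fun t => (ψ t).2, _, _, hd'.fst, hd'.snd, ?_, ?_, ?_⟩
  · simp [h0]
  · simp [h0]
  · filter_upwards [hev] with t ht
    have := congrArg Prod.fst ht
    simp only [f, u₀, AL, BL] at this
    simp only [LinearMap.coe_toContinuousLinearMap', Matrix.mulVecLin_apply, hv, zero_smul,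
      add_zero, sub_self] at this
    rw [Matrix.add_mulVec, Matrix.smul_mulVec]
    exact sub_eq_zero.1 this

section

open Topology Matrix

theorem Matrix.IsSymm.dotProduct_mulVec_comm {ι : Type*} [Fintype ι] {A : Matrix ι ι ℝ}
    (hA : A.IsSymm) (v w : ι → ℝ) : v ⬝ᵥ A *ᵥ w = (A *ᵥ v) ⬝ᵥ w := by
  rw [Matrix.dotProduct_mulVec, ← Matrix.mulVec_transpose, hA.eq]

theorem HasDerivAt.dotProduct {ι : Type*} [Fintype ι] {x y : ℝ → ι → ℝ} {x' y' : ι → ℝ} {t : ℝ}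
    (hx : HasDerivAt x x' t) (hy : HasDerivAt y y' t) :
    HasDerivAt (fun t => x t ⬝ᵥ y t) (x' ⬝ᵥ y t + x t ⬝ᵥ y') t := by
  rw [hasDerivAt_pi] at hx hy
  simp only [_root_.dotProduct, ← Finset.sum_add_distrib]
  exact HasDerivAt.fun_sum fun i _ => (hx i).mul (hy i)

theorem HasDerivAt.mulVec_const {ι : Type*} [Fintype ι] {x : ℝ → ι → ℝ} {x' : ι → ℝ} {t : ℝ}
    (hx : HasDerivAt x x' t) (A : Matrix ι ι ℝ) :
    HasDerivAt (fun t => A *ᵥ x t) (A *ᵥ x') t :=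
  (LinearMap.toContinuousLinearMap (Matrix.mulVecLin A)).hasFDerivAt.comp_hasDerivAt t hx

/-- First order perturbation theory of the eigenpairs of a real symmetric matrix. -/
theorem Matrix.IsSymm.exists_eigenpair_curve {ι : Type*} [Fintype ι] [DecidableEq ι]
    {A B : Matrix ι ι ℝ} (hA : A.IsSymm) {v : ι → ι → ℝ} {e : ι → ℝ}
    (he : Function.Injective e) (hv : ∀ i, A *ᵥ v i = e i • v i) (hvv : ∀ i, v i ⬝ᵥ v i = 1)
    (i : ι) :
    ∃ (x : ℝ → ι → ℝ) (E : ℝ → ℝ) (x' : ι → ℝ),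
      HasDerivAt x x' 0 ∧ HasDerivAt E (v i ⬝ᵥ B *ᵥ v i) 0 ∧ x 0 = v i ∧ E 0 = e i ∧
      (∀ᶠ t in 𝓝 (0 : ℝ), (A + t • B) *ᵥ x t = E t • x t) ∧
      ∀ k, k ≠ i → (e i - e k) * (v k ⬝ᵥ x') = v k ⬝ᵥ B *ᵥ v i := by
  obtain ⟨x, E, x', E', hx, hE, hx0, hE0, hev⟩ := hA.exists_hasDerivAt_eigenpair B he hv hvv i
  -- The eigenvalue equation, paired with `v k` and differentiated at `0`. Taking `k = i` yields
  -- `E'`; the others yield the components of `x'`.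
  have key : ∀ k, e k * (v k ⬝ᵥ x') + v k ⬝ᵥ B *ᵥ v i = E' * (v k ⬝ᵥ v i) + e i * (v k ⬝ᵥ x') := by
    intro k
    have h1 : HasDerivAt (fun t => v k ⬝ᵥ (A *ᵥ x t) + t * (v k ⬝ᵥ (B *ᵥ x t)))
        (v k ⬝ᵥ A *ᵥ x' + v k ⬝ᵥ B *ᵥ v i) 0 := by
      have h := ((hasDerivAt_const (0 : ℝ) (v k)).dotProduct (hx.mulVec_const A)).add
        ((hasDerivAt_id (0 : ℝ)).mul
          ((hasDerivAt_const (0 : ℝ) (v k)).dotProduct (hx.mulVec_const B)))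
      refine h.congr_deriv ?_
      simp [hx0]
    have h2 : HasDerivAt (fun t => E t * (v k ⬝ᵥ x t))
        (E' * (v k ⬝ᵥ v i) + e i * (v k ⬝ᵥ x')) 0 := by
      refine (hE.mul ((hasDerivAt_const (0 : ℝ) (v k)).dotProduct hx)).congr_deriv ?_
      simp [hx0, hE0]
    have h3 : (fun t => v k ⬝ᵥ (A *ᵥ x t) + t * (v k ⬝ᵥ (B *ᵥ x t))) =ᶠ[𝓝 0]
        fun t => E t * (v k ⬝ᵥ x t) := by
      filter_upwards [hev] with t ht
      have := congrArg (fun y => v k ⬝ᵥ y) ht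
      simpa [Matrix.add_mulVec, Matrix.smul_mulVec, dotProduct_add, dotProduct_smul] using this
    have h4 := (h2.congr_of_eventuallyEq h3).unique h1
    rw [hA.dotProduct_mulVec_comm, hv, smul_dotProduct, smul_eq_mul] at h4
    exact h4.symm
  have hE' : E' = v i ⬝ᵥ B *ᵥ v i := by
    have := key i
    rw [hvv] at this
    linarith
  refine ⟨x, E, x', hx, hE' ▸ hE, hx0, hE0, hev, fun k hk => ?_⟩
  have horth : v k ⬝ᵥ v i = 0 := by
    have h := hA.dotProduct_mulVec_comm (v k) (v i)
    rw [hv, hv, smul_dotProduct, dotProduct_smul, smul_eq_mul, smul_eq_mul] at h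
    have : (e i - e k) * (v k ⬝ᵥ v i) = 0 := by linarith
    exact (mul_eq_zero.1 this).resolve_left (sub_ne_zero.2 fun h => hk (he h).symm)
  have := key k
  rw [horth] at this
  linarith

/-! ### Generic spectra and product vectors -/

/-- The sums `E a + E b` of two levels are pairwise distinct; equivalently, all the levels and all
the gaps between them are nondegenerate. -/
def HasGenericGaps {ι R : Type*} [Add R] (E : ι → R) : Prop :=
  ∀ a b c d, E a + E b = E c + E d → (a = c ∧ b = d) ∨ (a = d ∧ b = c)

theorem HasGenericGaps.injective {ι : Type*} {E : ι → ℝ} (h : HasGenericGaps E) :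
    Function.Injective E := by
  intro a b hab
  rcases h a a b b (by rw [hab]) with h | h <;> exact h.1

/-- The real symmetric matrix `H` has nondegenerate levels and gaps, and the observable `Z`
distinguishes its eigenvectors. -/
def HasGenericSpectrum {ι : Type*} [Fintype ι] (H Z : Matrix ι ι ℝ) : Prop :=
  ∃ (v : ι → ι → ℝ) (E : ι → ℝ), (∀ i, H *ᵥ v i = E i • v i) ∧ (∀ i, v i ⬝ᵥ v i = 1) ∧
    HasGenericGaps E ∧ Function.Injective fun i => v i ⬝ᵥ Z *ᵥ v i

theorem HasGenericSpectrum.reindex {ι κ : Type*} [Fintype ι] [Fintype κ] {H Z : Matrix ι ι ℝ}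
    (h : HasGenericSpectrum H Z) (f : ι ≃ κ) :
    HasGenericSpectrum (H.submatrix f.symm f.symm) (Z.submatrix f.symm f.symm) := by
  obtain ⟨v, E, h1, h2, h3, h4⟩ := h
  have hmul : ∀ (A : Matrix ι ι ℝ) (w : ι → ℝ),
      A.submatrix f.symm f.symm *ᵥ (w ∘ f.symm) = (A *ᵥ w) ∘ f.symm := fun A w => by
    rw [Matrix.submatrix_mulVec_equiv]
    congr 2
    ext; simp
  have hdot : ∀ u w : ι → ℝ, (u ∘ f.symm) ⬝ᵥ (w ∘ f.symm) = u ⬝ᵥ w := fun u w => by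
    simp [dotProduct, Equiv.sum_comp f.symm fun i => u i * w i]
  refine ⟨fun k => v (f.symm k) ∘ f.symm, fun k => E (f.symm k), fun k => ?_, fun k => ?_, ?_, ?_⟩
  · rw [hmul, h1]; rfl
  · rw [hdot, h2]
  · intro a b c d habcd
    simpa using h3 _ _ _ _ habcd
  · intro a b hab
    simp only [hmul, hdot] at hab
    exact f.symm.injective (h4 hab)

/-- The product vector. -/
def tensorVec {ι κ : Type*} (v : ι → ℝ) (w : κ → ℝ) : ι × κ → ℝ := fun p => v p.1 * w p.2

theorem kronecker_mulVec_tensorVec {ι κ : Type*} [Fintype ι] [Fintype κ]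
    (A : Matrix ι ι ℝ) (B : Matrix κ κ ℝ) (v : ι → ℝ) (w : κ → ℝ) :
    (kroneckerMap (· * ·) A B) *ᵥ tensorVec v w = tensorVec (A *ᵥ v) (B *ᵥ w) := by
  ext ⟨i, k⟩
  simp only [mulVec, dotProduct, tensorVec, kroneckerMap_apply, Fintype.sum_prod_type,
    Finset.sum_mul_sum]
  exact Finset.sum_congr rfl fun _ _ => Finset.sum_congr rfl fun _ _ => by ring

theorem tensorVec_dotProduct {ι κ : Type*} [Fintype ι] [Fintype κ]
    (v v' : ι → ℝ) (w w' : κ → ℝ) :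
    tensorVec v w ⬝ᵥ tensorVec v' w' = (v ⬝ᵥ v') * (w ⬝ᵥ w') := by
  simp only [dotProduct, tensorVec, Fintype.sum_prod_type, Finset.sum_mul_sum]
  exact Finset.sum_congr rfl fun _ _ => Finset.sum_congr rfl fun _ _ => by ring

theorem tensorVec_smul {ι κ : Type*} (a : ℝ) (v : ι → ℝ) (w : κ → ℝ) :
    tensorVec v (a • w) = a • tensorVec v w := by
  ext; simp [tensorVec]; ring

theorem smul_tensorVec {ι κ : Type*} (a : ℝ) (v : ι → ℝ) (w : κ → ℝ) :
    tensorVec (a • v) w = a • tensorVec v w := by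
  ext; simp [tensorVec]; ring

theorem tensorVec_add {ι κ : Type*} (v : ι → ℝ) (w w' : κ → ℝ) :
    tensorVec v (w + w') = tensorVec v w + tensorVec v w' := by
  ext; simp [tensorVec]; ring

/-- The field `h` along `z` and `g` along `x` on a qubit. -/
def fieldMatrix (g h : ℝ) : Matrix (Fin 2) (Fin 2) ℝ := !![h, g; g, -h]

end

/-! ### Adding one spin to a chain -/

section

open Topology Matrix

theorem fieldMatrix_isSymm (g h : ℝ) : (fieldMatrix g h).IsSymm := by
  ext i j; fin_cases i <;> fin_cases j <;> rfl

/-- The sign of a spin. -/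
def spinSign : Fin 2 → ℝ := ![1, -1]

/-- The eigenvectors of `7/25 Z + 24/25 X`. -/
noncomputable def tiltedSpin : Fin 2 → Fin 2 → ℝ := ![![4/5, 3/5], ![3/5, -4/5]]

theorem fieldMatrix_mulVec_tiltedSpin (r : ℝ) (s : Fin 2) :
    fieldMatrix (24/25 * r) (7/25 * r) *ᵥ tiltedSpin s = (spinSign s * r) • tiltedSpin s := by
  ext k
  fin_cases s <;> fin_cases k <;> simp [fieldMatrix, tiltedSpin, spinSign] <;> ring

theorem tiltedSpin_dotProduct_self (s : Fin 2) : tiltedSpin s ⬝ᵥ tiltedSpin s = 1 := by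
  fin_cases s <;> simp [tiltedSpin] <;> norm_num

/-- Both coefficients must be nonzero: the diagonal one lets the coupling shift the levels at first
order, the off-diagonal one lets it tilt the new spin. The triple 7, 24, 25 keeps everything
rational. -/
theorem pauliZ_mulVec_tiltedSpin (s : Fin 2) :
    fieldMatrix 0 1 *ᵥ tiltedSpin s =
      (7/25 * spinSign s) • tiltedSpin s + (24/25 : ℝ) • tiltedSpin (1 - s) := by
  ext k
  fin_cases s <;> fin_cases k <;> simp [fieldMatrix, tiltedSpin, spinSign] <;> norm_num

theorem tiltedSpin_dotProduct_compl (s : Fin 2) : tiltedSpin (1 - s) ⬝ᵥ tiltedSpin s = 0 := by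
  fin_cases s <;> simp [tiltedSpin] <;> norm_num

theorem tiltedSpin_dotProduct_pauliZ (s : Fin 2) :
    tiltedSpin s ⬝ᵥ fieldMatrix 0 1 *ᵥ tiltedSpin s = 7/25 * spinSign s := by
  have h := tiltedSpin_dotProduct_compl (1 - s)
  rw [sub_sub_cancel] at h
  rw [pauliZ_mulVec_tiltedSpin, dotProduct_add, dotProduct_smul, dotProduct_smul,
    tiltedSpin_dotProduct_self, h]
  simp

theorem tiltedSpin_compl_dotProduct_pauliZ (s : Fin 2) :
    tiltedSpin (1 - s) ⬝ᵥ fieldMatrix 0 1 *ᵥ tiltedSpin s = 24/25 := by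
  rw [pauliZ_mulVec_tiltedSpin, dotProduct_add, dotProduct_smul, dotProduct_smul,
    tiltedSpin_dotProduct_self, tiltedSpin_dotProduct_compl]
  simp

theorem spinSign_compl (s : Fin 2) : spinSign (1 - s) = - spinSign s := by
  fin_cases s <;> simp [spinSign]

theorem spinSign_mul_self (s : Fin 2) : spinSign s * spinSign s = 1 := by
  fin_cases s <;> simp [spinSign]

theorem spinSign_injective : Function.Injective spinSign := by
  intro s t h
  fin_cases s <;> fin_cases t <;> simp [spinSign] at h ⊢ <;> norm_num at h

theorem hasGenericSpectrum_qubit :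
    HasGenericSpectrum (fieldMatrix (24/25) (7/25)) (fieldMatrix 0 1) := by
  refine ⟨tiltedSpin, spinSign, fun s => ?_, tiltedSpin_dotProduct_self, ?_, fun s t h => ?_⟩
  · simpa using fieldMatrix_mulVec_tiltedSpin 1 s
  · intro a b c d h
    fin_cases a <;> fin_cases b <;> fin_cases c <;> fin_cases d <;>
      simp [spinSign] at h ⊢ <;> norm_num at h
  · simp only [tiltedSpin_dotProduct_pauliZ] at h
    exact spinSign_injective (by linarith)

/-- The chain `H`, whose last spin has `z`-component `Z`, extended by one spin. -/
def extendChain {ι : Type*} [DecidableEq ι] (H Z : Matrix ι ι ℝ) (g h J : ℝ) :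
    Matrix (ι × Fin 2) (ι × Fin 2) ℝ :=
  (kroneckerMap (· * ·) H 1 + kroneckerMap (· * ·) 1 (fieldMatrix g h)) +
    J • kroneckerMap (· * ·) Z (fieldMatrix 0 1)

theorem Matrix.IsSymm.kronecker {ι κ : Type*} {A : Matrix ι ι ℝ} {B : Matrix κ κ ℝ}
    (hA : A.IsSymm) (hB : B.IsSymm) : (kroneckerMap (· * ·) A B).IsSymm := by
  ext ⟨i, k⟩ ⟨j, l⟩
  simp [hA.apply, hB.apply]

/-- The bracket is an integer, so a nonzero value would give a multiple of `r` too large to cancel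
`x`. A sum of two signs determines the signs up to order. -/
theorem sum_spinSign_eq {r x : ℝ} (hx : |x| < r) {a b c d : Fin 2}
    (h : x + (spinSign a + spinSign b - spinSign c - spinSign d) * r = 0) :
    x = 0 ∧ ((a = c ∧ b = d) ∨ (a = d ∧ b = c)) := by
  have h1 := abs_lt.1 hx
  have hr : 0 < r := (abs_nonneg x).trans_lt hx
  fin_cases a <;> fin_cases b <;> fin_cases c <;> fin_cases d <;>
    simp [spinSign] at h ⊢ <;> linarith

/-- Either `f` is nonzero at `0` and continuous there, or it has a simple, hence isolated, zero.
This is how a first order shift lifts a degeneracy. -/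
theorem HasDerivAt.eventually_punctured_ne_zero {f : ℝ → ℝ} {f' : ℝ} (hf : HasDerivAt f f' 0)
    (h : f 0 = 0 → f' ≠ 0) : ∀ᶠ t in 𝓝[≠] (0 : ℝ), f t ≠ 0 := by
  by_cases h0 : f 0 = 0
  · simpa [h0] using hf.eventually_ne (c := 0) (h h0)
  · exact (hf.continuousAt.eventually_ne h0).filter_mono nhdsWithin_le_nhds

/-- The new spin is first decoupled, in a tilted field so strong that two sums of levels agree only
if the old parts and the new signs agree separately. The only nontrivial coincidences left exchange
the new signs between two old levels `i`, `j`. A small coupling `t` splits them at first order by a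
nonzero multiple of `z i - z j`, which is where the hypothesis on `Z` enters. The expectation of the
new spin, at `t = 0` dependent on its sign alone, acquires a slope proportional to `z i`, so the
property is inherited. -/
theorem HasGenericSpectrum.exists_extendChain {ι : Type*} [Fintype ι] [DecidableEq ι]
    {H Z : Matrix ι ι ℝ} (hH : H.IsSymm) (h : HasGenericSpectrum H Z) :
    ∃ g h J : ℝ, HasGenericSpectrum (extendChain H Z g h J)
      (kroneckerMap (· * ·) 1 (fieldMatrix 0 1)) := by
  obtain ⟨v, e, hv, hvv, hgap, hz⟩ := h
  obtain ⟨r, hr0, hr⟩ : ∃ r : ℝ, 0 < r ∧ ∀ a b c d, |e a + e b - e c - e d| < r := by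
    obtain ⟨M, hM⟩ := Finite.exists_le fun q : ι × ι × ι × ι =>
      |e q.1 + e q.2.1 - e q.2.2.1 - e q.2.2.2|
    exact ⟨max M 0 + 1, by positivity, fun a b c d =>
      (hM (a, b, c, d)).trans_lt ((le_max_left M 0).trans_lt (lt_add_one _))⟩
  set A := kroneckerMap (· * ·) H 1 +
    kroneckerMap (· * ·) 1 (fieldMatrix (24/25 * r) (7/25 * r)) with hAdef
  set B := kroneckerMap (· * ·) Z (fieldMatrix 0 1) with hBdef
  set Z' : Matrix (ι × Fin 2) (ι × Fin 2) ℝ := kroneckerMap (· * ·) 1 (fieldMatrix 0 1) with hZdef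
  have hA : A.IsSymm := (hH.kronecker Matrix.isSymm_one).add
    (Matrix.isSymm_one.kronecker (fieldMatrix_isSymm _ _))
  have hZ' : Z'.IsSymm := Matrix.isSymm_one.kronecker (fieldMatrix_isSymm _ _)
  let V : ι × Fin 2 → ι × Fin 2 → ℝ := fun p => tensorVec (v p.1) (tiltedSpin p.2)
  let e' : ι × Fin 2 → ℝ := fun p => e p.1 + spinSign p.2 * r
  let z : ι → ℝ := fun i => v i ⬝ᵥ Z *ᵥ v i
  have hV : ∀ p, A *ᵥ V p = e' p • V p := fun p => by
    rw [hAdef, add_mulVec, kronecker_mulVec_tensorVec, kronecker_mulVec_tensorVec, one_mulVec,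
      one_mulVec, hv, fieldMatrix_mulVec_tiltedSpin, tensorVec_smul, smul_tensorVec, ← add_smul]
  have hVV : ∀ p, V p ⬝ᵥ V p = 1 := fun p => by
    rw [tensorVec_dotProduct, hvv, tiltedSpin_dotProduct_self, one_mul]
  have hsum : ∀ a b c d, e' a + e' b - e' c - e' d = 0 →
      e a.1 + e b.1 - e c.1 - e d.1 = 0 ∧
        ((a.2 = c.2 ∧ b.2 = d.2) ∨ (a.2 = d.2 ∧ b.2 = c.2)) := fun a b c d habcd =>
    sum_spinSign_eq (hr _ _ _ _) (by simp only [e'] at habcd; linarith)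
  have he' : Function.Injective e' := by
    intro a b hab
    obtain ⟨h1, h2⟩ := hsum a a b b (by rw [hab]; ring)
    exact Prod.ext (hgap.injective (by linarith)) (by tauto)
  choose x E x' hx hE hx0 hE0 hev hoff using hA.exists_eigenpair_curve (B := B) he' hV hVV
  have hBV : ∀ p, V p ⬝ᵥ B *ᵥ V p = 7/25 * spinSign p.2 * z p.1 := fun p => by
    rw [hBdef, kronecker_mulVec_tensorVec, tensorVec_dotProduct, tiltedSpin_dotProduct_pauliZ,
      mul_comm]
  -- the derivative of the expectation of the last spin
  have hzd : ∀ p, HasDerivAt (fun t => (x p t ⬝ᵥ Z' *ᵥ x p t) / (x p t ⬝ᵥ x p t))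
      ((24/25) ^ 2 * spinSign p.2 / r * z p.1) 0 := by
    rintro ⟨i, s⟩
    have h1 := (hx (i, s)).dotProduct ((hx (i, s)).mulVec_const Z')
    have h2 := (hx (i, s)).dotProduct (hx (i, s))
    have h3 := h1.div h2 (by rw [hx0, hVV]; exact one_ne_zero)
    refine h3.congr_deriv ?_
    rw [hx0, hVV]
    have hZV : Z' *ᵥ V (i, s) = (7/25 * spinSign s) • V (i, s) + (24/25 : ℝ) • V (i, 1 - s) := by
      rw [hZdef, kronecker_mulVec_tensorVec, one_mulVec, pauliZ_mulVec_tiltedSpin, tensorVec_add,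
        tensorVec_smul, tensorVec_smul]
    have horth : V (i, s) ⬝ᵥ V (i, 1 - s) = 0 := by
      rw [tensorVec_dotProduct, dotProduct_comm (tiltedSpin _), tiltedSpin_dotProduct_compl,
        mul_zero]
    have hne : ((i, 1 - s) : ι × Fin 2) ≠ (i, s) := by
      fin_cases s <;> simp
    have h4 := hoff (i, s) (i, 1 - s) hne
    rw [show V (i, 1 - s) ⬝ᵥ B *ᵥ V (i, s) = z i * (24/25) by
      rw [hBdef, kronecker_mulVec_tensorVec, tensorVec_dotProduct,
        tiltedSpin_compl_dotProduct_pauliZ]] at h4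
    simp only [e', spinSign_compl] at h4
    rw [hZ'.dotProduct_mulVec_comm (V (i, s)), hZV, dotProduct_add, add_dotProduct,
      dotProduct_add, dotProduct_smul, dotProduct_smul, dotProduct_smul, dotProduct_smul,
      smul_dotProduct, smul_dotProduct, hVV, horth, dotProduct_comm (x' _),
      dotProduct_comm (x' _)]
    simp only [smul_eq_mul]
    have hs := spinSign_mul_self s
    field_simp
    -- The only component of `x'` that contributes is the one along the flipped spin, at energy
    -- distance `2 * spinSign s * r`; the component along `V (i, s)` drops out of the normalized
    -- expectation.
    have h5 : V (i, 1 - s) ⬝ᵥ x' (i, s) * r = z i * (12/25) * spinSign s := by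
      linear_combination (spinSign s / 2) * h4 - V (i, 1 - s) ⬝ᵥ x' (i, s) * r * hs
    linear_combination 1200 * h5
  have hgaps : ∀ q : (ι × Fin 2) × (ι × Fin 2) × (ι × Fin 2) × (ι × Fin 2), ∀ᶠ t in 𝓝[≠] (0 : ℝ),
      E q.1 t + E q.2.1 t = E q.2.2.1 t + E q.2.2.2 t →
        (q.1 = q.2.2.1 ∧ q.2.1 = q.2.2.2) ∨ (q.1 = q.2.2.2 ∧ q.2.1 = q.2.2.1) := by
    rintro ⟨a, b, c, d⟩
    by_cases htriv : (a = c ∧ b = d) ∨ (a = d ∧ b = c)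
    · exact Eventually.of_forall fun _ _ => htriv
    have hd := (((hE a).add (hE b)).sub (hE c)).sub (hE d)
    refine (hd.eventually_punctured_ne_zero ?_).mono fun t ht h => (ht ?_).elim
    · simp only [Pi.add_apply, Pi.sub_apply, hE0, hBV]
      intro h0
      obtain ⟨h1, h2⟩ := hsum a b c d h0
      have h3 := hgap a.1 b.1 c.1 d.1 (by linarith)
      obtain ⟨i, s⟩ := a
      obtain ⟨j, s'⟩ := b
      obtain ⟨k, u⟩ := c
      obtain ⟨l, u'⟩ := d
      simp only [Prod.mk.injEq] at htriv h2 h3 ⊢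
      -- The first order splitting of the crossed pair factors as `(s - s') * (z i - z j)`, up to
      -- the factor `7/25`.
      have hfin : ¬ (i = j ∨ s = s') → 7/25 * spinSign s * z i + 7/25 * spinSign s' * z j
          - 7/25 * spinSign s' * z i - 7/25 * spinSign s * z j ≠ 0 := by
        intro hij h5
        push Not at hij
        have h6 : (spinSign s - spinSign s') * (z i - z j) = 0 := by linarith
        rcases mul_eq_zero.1 h6 with h7 | h7
        · exact hij.2 (spinSign_injective (sub_eq_zero.1 h7))
        · exact hij.1 (hz (sub_eq_zero.1 h7))
      rcases h3 with ⟨rfl, rfl⟩ | ⟨rfl, rfl⟩ <;> rcases h2 with ⟨rfl, rfl⟩ | ⟨rfl, rfl⟩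
      · tauto
      · exact hfin (by rintro (rfl | rfl) <;> tauto)
      · have := hfin (by rintro (rfl | rfl) <;> tauto)
        intro h5; exact this (by linarith)
      · tauto
    · simp only [Pi.add_apply, Pi.sub_apply]
      linarith
  have hzinj : ∀ q : (ι × Fin 2) × (ι × Fin 2), ∀ᶠ t in 𝓝[≠] (0 : ℝ),
      (x q.1 t ⬝ᵥ Z' *ᵥ x q.1 t) / (x q.1 t ⬝ᵥ x q.1 t) =
        (x q.2 t ⬝ᵥ Z' *ᵥ x q.2 t) / (x q.2 t ⬝ᵥ x q.2 t) → q.1 = q.2 := by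
    rintro ⟨⟨i, s⟩, ⟨j, s'⟩⟩
    by_cases htriv : ((i, s) : ι × Fin 2) = (j, s')
    · exact Eventually.of_forall fun _ _ => htriv
    have hd := (hzd (i, s)).sub (hzd (j, s'))
    refine (hd.eventually_punctured_ne_zero ?_).mono fun t ht h => (ht ?_).elim
    · simp only [Pi.sub_apply, hx0, hVV, div_one]
      have hZV : ∀ p, V p ⬝ᵥ Z' *ᵥ V p = 7/25 * spinSign p.2 := fun p => by
        rw [hZdef, kronecker_mulVec_tensorVec, tensorVec_dotProduct, tiltedSpin_dotProduct_pauliZ,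
          one_mulVec, hvv, one_mul]
      rw [hZV, hZV]
      intro h0
      obtain rfl : s = s' := spinSign_injective (by simp only at h0; linarith)
      rw [← mul_sub]
      refine mul_ne_zero (div_ne_zero (mul_ne_zero (by norm_num) ?_) hr0.ne') (sub_ne_zero.2 ?_)
      · intro h; simpa [h] using spinSign_mul_self s
      · intro h; exact htriv (by rw [hz h])
    · exact sub_eq_zero.2 h
  -- The perturbed eigenvectors are not of unit length; they are rescaled below, which is why the
  -- expectation was taken as a quotient.
  have hpos : ∀ p, ∀ᶠ t in 𝓝[≠] (0 : ℝ), 0 < x p t ⬝ᵥ x p t := fun p => by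
    refine (((hx p).dotProduct (hx p)).continuousAt.eventually_const_lt ?_).filter_mono
      nhdsWithin_le_nhds
    simp only [hx0, hVV, one_pos]
  -- Finitely many conditions, each valid for all small `t ≠ 0`; any common such `t` is the
  -- coupling.
  obtain ⟨t, ht1, ht2, ht3, ht4⟩ := ((eventually_all.2 hgaps).and ((eventually_all.2 hzinj).and
    ((eventually_all.2 hpos).and ((eventually_all.2 hev).filter_mono nhdsWithin_le_nhds)))).exists
  refine ⟨24/25 * r, 7/25 * r, t, fun p => (√(x p t ⬝ᵥ x p t))⁻¹ • x p t, fun p => E p t,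
    fun p => ?_, fun p => ?_, fun a b c d => ht1 (a, b, c, d), fun p q hpq => ht2 (p, q) ?_⟩
  · have := ht4 p
    rw [mulVec_smul, smul_comm, ← this]
    rfl
  · rw [smul_dotProduct, dotProduct_smul, smul_smul, smul_eq_mul, ← mul_inv,
      Real.mul_self_sqrt (ht3 p).le, inv_mul_cancel₀ (ht3 p).ne']
  · simp only [mulVec_smul, smul_dotProduct, dotProduct_smul, smul_eq_mul, ← mul_assoc] at hpq
    rw [← mul_inv, ← mul_inv, Real.mul_self_sqrt (ht3 _).le, Real.mul_self_sqrt (ht3 _).le] at hpq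
    rw [div_eq_inv_mul, div_eq_inv_mul]
    exact hpq

end

/-! ### A generic Ising chain -/

section

open Topology Matrix

/-- The real matrix of the Ising chain of `N + 1` spins with transverse fields `g`, longitudinal
fields `h` and couplings `J`. -/
noncomputable def isingMatrix (N : ℕ) (g h J : ℕ → ℝ) :
    Matrix (Fin (N + 1) → Fin 2) (Fin (N + 1) → Fin 2) ℝ :=
  Matrix.of fun a b =>
    (∑ l : Fin (N + 1), if ∀ k, k ≠ l → a k = b k then fieldMatrix (g l) (h l) (a l) (b l) else 0) +
      ∑ l : Fin N, if a = b then J l * (spinSign (a l.castSucc) * spinSign (a l.succ)) else 0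

/-- The Pauli matrix `Z` on the last spin. -/
noncomputable def lastSpinMatrix (N : ℕ) : Matrix (Fin (N + 1) → Fin 2) (Fin (N + 1) → Fin 2) ℝ :=
  Matrix.diagonal fun a => spinSign (a (Fin.last N))

theorem fieldMatrix_zero_one : fieldMatrix 0 1 = Matrix.diagonal spinSign := by
  ext i j; fin_cases i <;> fin_cases j <;> simp [fieldMatrix, spinSign]

/-- Appending a last spin. -/
def snocSpin (N : ℕ) : (Fin N → Fin 2) × Fin 2 ≃ (Fin (N + 1) → Fin 2) where
  toFun p := Fin.snoc (α := fun _ => Fin 2) p.1 p.2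
  invFun a := (Fin.init a, a (Fin.last N))
  left_inv p := by simp
  right_inv a := by simp

theorem isingMatrix_isSymm (N : ℕ) (g h J : ℕ → ℝ) : (isingMatrix N g h J).IsSymm := by
  ext a b
  simp only [isingMatrix, transpose_apply, of_apply]
  congr 1
  · refine Finset.sum_congr rfl fun l _ => ?_
    rw [(fieldMatrix_isSymm (g l) (h l)).apply]
    simp only [eq_comm]
  · refine Finset.sum_congr rfl fun l _ => ?_
    by_cases hab : a = b
    · subst hab; rfl
    · rw [if_neg hab, if_neg (Ne.symm hab)]

theorem lastSpinMatrix_succ (N : ℕ) :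
    lastSpinMatrix (N + 1) = (kroneckerMap (· * ·) (1 : Matrix (Fin (N + 1) → Fin 2) _ ℝ)
      (fieldMatrix 0 1)).submatrix (snocSpin (N + 1)).symm (snocSpin (N + 1)).symm := by
  rw [fieldMatrix_zero_one, ← Matrix.diagonal_one, Matrix.diagonal_kronecker_diagonal,
    Matrix.submatrix_diagonal_equiv]
  ext a b
  simp [lastSpinMatrix, snocSpin, Matrix.diagonal_apply]

theorem forall_ne_castSucc_iff {N : ℕ} (a b : Fin (N + 1) → Fin 2) (l : Fin N) :
    (∀ k, k ≠ l.castSucc → a k = b k) ↔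
      (∀ k, k ≠ l → Fin.init a k = Fin.init b k) ∧ a (Fin.last N) = b (Fin.last N) := by
  constructor
  · intro H
    exact ⟨fun k hk => H _ (by simpa using hk), H _ (Fin.castSucc_lt_last l).ne'⟩
  · rintro ⟨h1, h2⟩ k hk
    induction k using Fin.lastCases with
    | last => exact h2
    | cast k => exact h1 k (by simpa using hk)

theorem forall_ne_last_iff {N : ℕ} (a b : Fin (N + 1) → Fin 2) :
    (∀ k, k ≠ Fin.last N → a k = b k) ↔ Fin.init a = Fin.init b := by
  constructor
  · intro H
    ext k
    simp [Fin.init, H _ (Fin.castSucc_lt_last k).ne]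
  · intro H k hk
    induction k using Fin.lastCases with
    | last => exact (hk rfl).elim
    | cast k => exact congrFun H k

theorem ite_forall_ne_castSucc {N : ℕ} (a b : Fin (N + 1) → Fin 2) (l : Fin N)
    (F : Fin 2 → Fin 2 → ℝ) :
    (if ∀ k, k ≠ l.castSucc → a k = b k then F (a l.castSucc) (b l.castSucc) else 0) =
      if a (Fin.last N) = b (Fin.last N) then
        (if ∀ k, k ≠ l → Fin.init a k = Fin.init b k then F (Fin.init a l) (Fin.init b l) else 0)
      else 0 := by
  simp only [forall_ne_castSucc_iff]
  by_cases h1 : a (Fin.last N) = b (Fin.last N) <;>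
    by_cases h2 : ∀ k, k ≠ l → Fin.init a k = Fin.init b k
  · rw [if_pos ⟨h2, h1⟩, if_pos h1, if_pos h2]; rfl
  · rw [if_neg (fun h => h2 h.1), if_pos h1, if_neg h2]
  · rw [if_neg (fun h => h1 h.2), if_neg h1]
  · rw [if_neg (fun h => h1 h.2), if_neg h1]

theorem eq_iff_init_eq_and_last_eq {N : ℕ} (a b : Fin (N + 1) → Fin 2) :
    a = b ↔ Fin.init a = Fin.init b ∧ a (Fin.last N) = b (Fin.last N) := by
  rw [← (snocSpin N).symm.injective.eq_iff, Prod.ext_iff]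
  rfl

/-- All terms except the last field act trivially or diagonally on the last spin, and only the last
bond sees its sign. -/
theorem isingMatrix_succ (N : ℕ) (g h J : ℕ → ℝ) :
    isingMatrix (N + 1) g h J =
      (extendChain (isingMatrix N g h J) (lastSpinMatrix N) (g (N + 1)) (h (N + 1)) (J N)).submatrix
        (snocSpin (N + 1)).symm (snocSpin (N + 1)).symm := by
  ext a b
  have h1 : (∑ l : Fin (N + 2),
      if ∀ k, k ≠ l → a k = b k then fieldMatrix (g l) (h l) (a l) (b l) else 0) = _ :=
    Fin.sum_univ_castSucc _
  have h2 : (∑ l : Fin (N + 1),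
      if a = b then J l * (spinSign (a l.castSucc) * spinSign (a l.succ)) else 0) = _ :=
    Fin.sum_univ_castSucc _
  simp only [fun l : Fin (N + 1) => ite_forall_ne_castSucc a b l
    (fieldMatrix (g l.castSucc) (h l.castSucc))] at h1
  simp only [isingMatrix, of_apply, h1, h2]
  simp only [extendChain, snocSpin, Equiv.coe_fn_symm_mk,
    forall_ne_last_iff, eq_iff_init_eq_and_last_eq a b, submatrix_apply, Matrix.add_apply,
    Matrix.smul_apply, kroneckerMap_apply, of_apply, smul_eq_mul, Matrix.one_apply,
    lastSpinMatrix, fieldMatrix_zero_one, Matrix.diagonal_apply, Fin.val_castSucc, Fin.val_last,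
    Fin.succ_last]
  by_cases h3 : a (Fin.last (N + 1)) = b (Fin.last (N + 1)) <;>
    by_cases h4 : Fin.init a = Fin.init b
  · have h5 : ∀ l, a (Fin.castSucc l) = b (Fin.castSucc l) := congrFun h4
    simp only [h3, h4, if_true, and_self, mul_one, one_mul]
    simp only [Fin.init, h5, Fin.succ_castSucc]
    ring
  · simp [h3, h4]
  · simp [h3, h4]
  · simp [h3, h4]

/-- Induction on the length, starting from one tilted spin. Parameters are sequences on `ℕ`, so the
values updated for a longer chain are never read by the shorter one. -/
theorem exists_isingMatrix_hasGenericSpectrum (N : ℕ) :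
    ∃ g h J : ℕ → ℝ, HasGenericSpectrum (isingMatrix N g h J) (lastSpinMatrix N) := by
  induction N with
  | zero =>
    refine ⟨fun _ => 24/25, fun _ => 7/25, 0, ?_⟩
    convert hasGenericSpectrum_qubit.reindex (Equiv.funUnique (Fin 1) (Fin 2)).symm using 1
    · ext a b
      simp [isingMatrix]
    · rw [fieldMatrix_zero_one, Matrix.submatrix_diagonal_equiv]
      rfl
  | succ N ih =>
    obtain ⟨g, h, J, H⟩ := ih
    obtain ⟨g', h', J', H'⟩ := H.exists_extendChain (isingMatrix_isSymm N g h J)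
    refine ⟨Function.update g (N + 1) g', Function.update h (N + 1) h', Function.update J N J', ?_⟩
    rw [isingMatrix_succ, lastSpinMatrix_succ]
    refine HasGenericSpectrum.reindex ?_ _
    have : isingMatrix N (Function.update g (N + 1) g') (Function.update h (N + 1) h')
        (Function.update J N J') = isingMatrix N g h J := by
      ext a b
      simp only [isingMatrix, of_apply]
      congr 1
      · refine Finset.sum_congr rfl fun l _ => ?_
        rw [Function.update_of_ne l.2.ne, Function.update_of_ne l.2.ne]
      · refine Finset.sum_congr rfl fun l _ => ?_
        rw [Function.update_of_ne l.2.ne]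
    rw [this]
    simpa using H'

end

/-! ### Genericity as a polynomial condition -/

/-- The products `z a * z b` of two numbers are pairwise distinct. -/
def HasGenericProducts {ι R : Type*} [Mul R] (z : ι → R) : Prop :=
  ∀ a b c d, z a * z b = z c * z d → (a = c ∧ b = d) ∨ (a = d ∧ b = c)

open MvPolynomial in
/-- Nondegeneracy of the products of eigenvalues is the non-vanishing of a polynomial in the
entries of the matrix. -/
theorem exists_mvPolynomial_hasGenericProducts (ι : Type) [Fintype ι] [DecidableEq ι] :
    ∃ R : MvPolynomial (ι × ι) ℂ, ∀ (U : Matrix ι ι ℂ) (z : ι → ℂ),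
      U.charpoly = ∏ i, (Polynomial.X - Polynomial.C (z i)) →
      (aeval (fun q : ι × ι => U q.1 q.2) R ≠ 0 ↔ HasGenericProducts z) := by
  let T : Finset (ι × ι × ι × ι) := Finset.univ.filter fun q =>
    ¬ ((q.1 = q.2.2.1 ∧ q.2.1 = q.2.2.2) ∨ (q.1 = q.2.2.2 ∧ q.2.1 = q.2.2.1))
  -- A discriminant-like product over all nontrivial coincidences. It is symmetric in the
  -- eigenvalues, hence a polynomial in their elementary symmetric functions, which up to sign are
  -- the coefficients of the characteristic polynomial.
  let P : MvPolynomial ι ℂ := ∏ q ∈ T, (X q.1 * X q.2.1 - X q.2.2.1 * X q.2.2.2)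
  have hP : P.IsSymmetric := by
    intro σ
    simp only [P, map_prod, map_sub, map_mul, rename_X]
    exact Finset.prod_equiv (σ.prodCongr (σ.prodCongr (σ.prodCongr σ)))
      (fun q => by simp [T]) fun q _ => rfl
  obtain ⟨Q, hQ⟩ := esymmAlgHom_surjective (σ := ι) ℂ le_rfl ⟨P, hP⟩
  have hQ' : aeval (fun i : Fin (Fintype.card ι) => esymm ι ℂ (i + 1)) Q = P := by
    rw [← esymmAlgHom_apply, hQ]
  refine ⟨aeval (fun i : Fin (Fintype.card ι) => (-1) ^ (i + 1 : ℕ) *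
    (Matrix.charpoly.univ ℂ ι).coeff (Fintype.card ι - (i + 1))) Q, fun U z hU => ?_⟩
  have hval : aeval (fun q : ι × ι => U q.1 q.2) (aeval (fun i : Fin (Fintype.card ι) =>
      (-1) ^ (i + 1 : ℕ) * (Matrix.charpoly.univ ℂ ι).coeff (Fintype.card ι - (i + 1))) Q) =
      aeval z P := by
    rw [← hQ', comp_aeval_apply, comp_aeval_apply]
    congr 2
    funext i
    have h1 : aeval (fun q : ι × ι => U q.1 q.2)
        ((Matrix.charpoly.univ ℂ ι).coeff (Fintype.card ι - (i + 1))) =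
        U.charpoly.coeff (Fintype.card ι - (i + 1)) :=
      Matrix.charpoly.univ_coeff_eval₂Hom ι (algebraMap ℂ ℂ) (fun q : ι × ι => U q.1 q.2) _
    have h2 : ∏ i, (Polynomial.X - Polynomial.C (z i)) =
        ((Finset.univ.val.map z).map fun t => Polynomial.X - Polynomial.C t).prod := by
      rw [Multiset.map_map]; rfl
    have h3 : Fintype.card ι - (Fintype.card ι - (i + 1)) = (i : ℕ) + 1 := by
      have := i.2; omega
    rw [map_mul, map_pow, map_neg, map_one, h1, hU, h2, Multiset.prod_X_sub_C_coeff _ (by simp),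
      aeval_esymm_eq_multiset_esymm]
    simp only [Multiset.card_map, Finset.card_val, Finset.card_univ, h3]
    rw [← mul_assoc, ← mul_pow]
    simp
  rw [hval]
  simp only [P, map_prod, Finset.prod_ne_zero_iff, map_sub, map_mul, aeval_X, HasGenericProducts, T,
    Finset.mem_filter, Finset.mem_univ, true_and, Prod.forall, sub_ne_zero]
  exact forall₄_congr fun a b c d => not_imp_not

/-- Distinct eigenvalues, one per index, already exhaust the roots allowed by the degree. -/
theorem Matrix.charpoly_eq_prod_of_eigenvectors {ι : Type*} [Fintype ι] [DecidableEq ι]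
    {U : Matrix ι ι ℂ} {z : ι → ℂ} (hz : Function.Injective z) {v : ι → ι → ℂ}
    (hv : ∀ i, U.mulVec (v i) = z i • v i) (hv0 : ∀ i, v i ≠ 0) :
    U.charpoly = ∏ i, (Polynomial.X - Polynomial.C (z i)) := by
  have hle : Finset.univ.val.map z ≤ U.charpoly.roots := by
    rw [Multiset.le_iff_subset (Finset.univ.nodup.map hz)]
    intro w hw
    obtain ⟨i, -, rfl⟩ := Multiset.mem_map.1 hw
    rw [Polynomial.mem_roots U.charpoly_monic.ne_zero, Polynomial.IsRoot, Matrix.eval_charpoly,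
      ← Matrix.exists_mulVec_eq_zero_iff]
    refine ⟨v i, hv0 i, ?_⟩
    rw [Matrix.sub_mulVec, hv, Matrix.scalar_apply, ← Matrix.smul_one_eq_diagonal,
      Matrix.smul_mulVec, Matrix.one_mulVec, sub_self]
  have heq := Multiset.eq_of_le_of_card_le hle (by
    refine (Polynomial.card_roots' _).trans ?_
    rw [Matrix.charpoly_natDegree_eq_dim]; simp)
  rw [← Polynomial.prod_multiset_X_sub_C_of_monic_of_roots_card_eq U.charpoly_monic (by
    rw [← heq, Matrix.charpoly_natDegree_eq_dim]; simp), ← heq, Multiset.map_map]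
  rfl

theorem Matrix.exists_charpoly_eq_prod {ι : Type*} [Fintype ι] [DecidableEq ι]
    (U : Matrix ι ι ℂ) : ∃ z : ι → ℂ, U.charpoly = ∏ i, (Polynomial.X - Polynomial.C (z i)) := by
  have hs := IsAlgClosed.splits U.charpoly
  have hcard : U.charpoly.roots.card = Fintype.card ι := by
    rw [← hs.natDegree_eq_card_roots, Matrix.charpoly_natDegree_eq_dim]
  let f : ι ≃ U.charpoly.roots := Fintype.equivOfCardEq (by rw [← hcard, Multiset.card_coe])
  refine ⟨fun i => f i, ?_⟩
  rw [f.prod_comp fun r : U.charpoly.roots => Polynomial.X - Polynomial.C (r : ℂ)]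
  have h := congrArg (fun s => (s.map fun r => Polynomial.X - Polynomial.C r).prod)
    (Multiset.map_univ_coe U.charpoly.roots)
  rw [Multiset.map_map] at h
  refine Eq.trans ?_ h.symm
  rw [Polynomial.prod_multiset_X_sub_C_of_monic_of_roots_card_eq U.charpoly_monic]
  rw [hcard, Matrix.charpoly_natDegree_eq_dim]

/-! ### A Floquet operator with generic eigenvalue products -/

section

open Topology Matrix

open scoped Matrix.Norms.Operator in
theorem Matrix.exp_mulVec_of_eigenvector {ι : Type*} [Fintype ι] [DecidableEq ι]
    {A : Matrix ι ι ℂ} {v : ι → ℂ} {μ : ℂ} (h : A *ᵥ v = μ • v) :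
    NormedSpace.exp A *ᵥ v = Complex.exp μ • v := by
  have hpow : ∀ k : ℕ, A ^ k *ᵥ v = μ ^ k • v := by
    intro k
    induction k with
    | zero => simp
    | succ k ih => rw [pow_succ, ← mulVec_mulVec, h, mulVec_smul, ih, smul_smul, pow_succ, mul_comm]
  have h1 := NormedSpace.exp_series_hasSum_exp' (𝕂 := ℂ) A
  let L : Matrix ι ι ℂ →+ (ι → ℂ) :=
    { toFun := fun M => M *ᵥ v, map_zero' := zero_mulVec v, map_add' := fun M M' => add_mulVec M M' v }
  have h2 := h1.map L (by
    change Continuous fun M : Matrix ι ι ℂ => M *ᵥ v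
    fun_prop)
  have h3 := (NormedSpace.exp_series_hasSum_exp' (𝕂 := ℂ) μ).smul_const v
  rw [← Complex.exp_eq_exp_ℂ] at h3
  refine h2.unique ?_
  convert h3 using 2 with k
  simp [L, smul_mulVec, hpow, smul_smul]

theorem Matrix.list_reverse_prod_mulVec {ι κ R : Type*} [Fintype ι] [DecidableEq ι] [CommRing R]
    (l : List κ) {f : κ → Matrix ι ι R} {μ : κ → R} {v : ι → R} (h : ∀ j, f j *ᵥ v = μ j • v) :
    (l.map f).reverse.prod *ᵥ v = (l.map μ).prod • v := by
  induction l with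
  | nil => simp
  | cons j l ih =>
    rw [List.map_cons, List.reverse_cons, List.prod_append, List.prod_singleton, ← mulVec_mulVec, h,
      mulVec_smul, ih, smul_smul, List.map_cons, List.prod_cons]

namespace Floquet

theorem sum_axis {M : Type*} [AddCommMonoid M] (f : Axis → M) :
    ∑ u, f u = f Axis.x + (f Axis.y + f Axis.z) := by
  change ∑ u ∈ {Axis.x, Axis.y, Axis.z}, f u = _
  rw [Finset.sum_insert (by simp), Finset.sum_insert (by simp), Finset.sum_singleton]

/-- The parameters that realize the Ising chain in the first piece and nothing in the others. -/
def isingParam (E : Ensemble) (N : ℕ) (κ : ℝ) (g h J : ℕ → ℝ) : Param E.n (N + 1)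
  | Sum.inl (j, l, Axis.x) => if j = E.first then κ * g l else 0
  | Sum.inl (_, _, Axis.y) => 0
  | Sum.inl (j, l, Axis.z) => if j = E.first then κ * h l else 0
  | Sum.inr (j, l, Axis.z, Axis.z) => if j = E.first then κ * J l else 0
  | Sum.inr _ => 0

theorem sigma_z_eq_diagonal {N : ℕ} (l : Fin N) :
    sigma l Axis.z = Matrix.diagonal fun a => (spinSign (a l) : ℂ) := by
  ext a b
  rw [sigma, onSite, of_apply, diagonal_apply]
  by_cases hab : a = b
  · subst hab
    rw [if_pos fun _ _ => rfl, if_pos rfl, pauli]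
    generalize a l = s
    fin_cases s <;> simp [spinSign]
  · rw [if_neg hab]
    split_ifs with h
    · have : a l ≠ b l := fun hl => hab (funext fun k => by
        by_cases hk : k = l
        · rw [hk, hl]
        · exact h k hk)
      generalize a l = s at this ⊢
      generalize b l = t at this ⊢
      fin_cases s <;> fin_cases t <;> simp [pauli] at this ⊢
    · rfl

theorem pieceHamiltonian_isingParam_first (E : Ensemble) (hx : E.α E.first Axis.x = true)
    (hz : E.α E.first Axis.z = true) (hzz : E.γ E.first Axis.z Axis.z = true) (N : ℕ) (κ : ℝ)
    (g h J : ℕ → ℝ) :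
    E.pieceHamiltonian (isingParam E N κ g h J) E.first =
      (κ : ℂ) • (isingMatrix N g h J).map ((↑) : ℝ → ℂ) := by
  ext a b
  simp only [Ensemble.pieceHamiltonian, sum_axis, field, coupling, isingParam, hx, hz, hzz,
    if_true, Complex.ofReal_zero, ite_self, zero_smul, zero_add]
  simp only [Matrix.add_apply, Matrix.sum_apply, Matrix.smul_apply, Matrix.map_apply, isingMatrix,
    of_apply, Complex.ofReal_add, Complex.ofReal_sum, smul_eq_mul, mul_add, Finset.mul_sum]
  refine congrArg₂ (· + ·) (Finset.sum_congr rfl fun l _ => ?_)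
    (Finset.sum_congr rfl fun l _ => ?_)
  · simp only [sigma, onSite, of_apply]
    split_ifs with hab
    · generalize a l = s
      generalize b l = t
      fin_cases s <;> fin_cases t <;> simp [pauli, fieldMatrix]
    · simp
  · rw [sigma_z_eq_diagonal, sigma_z_eq_diagonal, diagonal_mul_diagonal, diagonal_apply]
    split_ifs with hab
    · simp only [Complex.ofReal_mul, mul_assoc]
      rfl
    · simp

theorem pieceHamiltonian_isingParam_of_ne (E : Ensemble) (N : ℕ) (κ : ℝ) (g h J : ℕ → ℝ)
    {j : Fin E.n} (hj : j ≠ E.first) :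
    E.pieceHamiltonian (isingParam E N κ g h J) j = 0 := by
  simp [Ensemble.pieceHamiltonian, sum_axis, field, coupling, isingParam, hj]

theorem Ensemble.duration_first_pos (E : Ensemble) : 0 < E.duration E.first 1 := by
  have h0 : E.time E.first.castSucc = 0 := E.time_zero
  have h1 : E.time E.first.castSucc < E.time E.first.succ :=
    E.time_strictMono Fin.castSucc_lt_succ
  rw [Ensemble.duration, h0] at *
  simp [h1]

/-- With only the first piece switched on, the Floquet operator is a single exponential of the Ising
chain. The products of its eigenvalues inherit genericity from the sums of levels, provided the
phases do not wrap around the circle. -/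
theorem exists_floquetOperator_hasGenericProducts (E : Ensemble) (hx : E.α E.first Axis.x = true)
    (hz : E.α E.first Axis.z = true) (hzz : E.γ E.first Axis.z Axis.z = true) (N : ℕ) :
    ∃ (p : Param E.n (N + 1)) (z : Basis (Fin (N + 1)) → ℂ), HasGenericProducts z ∧
      (E.floquetOperator p).charpoly = ∏ i, (Polynomial.X - Polynomial.C (z i)) := by
  obtain ⟨g, h, J, v, e, hv, hvv, hgap, -⟩ := exists_isingMatrix_hasGenericSpectrum N
  set τ := E.duration E.first 1 with hτ
  have hτ0 : 0 < τ := E.duration_first_pos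
  obtain ⟨M, hM0, hM⟩ : ∃ M : ℝ, 0 < M ∧ ∀ a b c d, |(e a + e b) - (e c + e d)| < M := by
    obtain ⟨M, hM⟩ := Finite.exists_le fun q : Basis (Fin (N + 1)) × Basis (Fin (N + 1)) ×
      Basis (Fin (N + 1)) × Basis (Fin (N + 1)) =>
      |(e q.1 + e q.2.1) - (e q.2.2.1 + e q.2.2.2)|
    exact ⟨max M 0 + 1, by positivity, fun a b c d =>
      (hM (a, b, c, d)).trans_lt ((le_max_left M 0).trans_lt (lt_add_one _))⟩
  -- This scale turns the phases into `e i / M`, so that two sums of phases differ by less than `1 <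
  -- 2π`.
  let κ := 1 / (τ * M)
  let z : Basis (Fin (N + 1)) → ℂ := fun i => Complex.exp (-Complex.I * (e i / M : ℝ))
  have hzgap : HasGenericProducts z := by
    intro a b c d habcd
    refine hgap a b c d ?_
    simp only [z, ← Complex.exp_add] at habcd
    obtain ⟨n, hn⟩ := Complex.exp_eq_exp_iff_exists_int.1 habcd
    have h1 : ((e a + e b) - (e c + e d)) / M = -(n * (2 * Real.pi)) := by
      have h2 : Complex.I * ((((e a + e b) - (e c + e d)) / M + n * (2 * Real.pi) : ℝ) : ℂ) = 0 := by
        push_cast at hn ⊢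
        linear_combination -hn
      have h3 := (mul_eq_zero.1 h2).resolve_left Complex.I_ne_zero
      rw [Complex.ofReal_eq_zero] at h3
      linarith
    have h4 : |((e a + e b) - (e c + e d)) / M| < 1 := by
      rw [abs_div, abs_of_pos hM0, div_lt_one hM0]; exact hM a b c d
    have h5 : n = 0 := by
      by_contra hn0
      rw [h1, abs_neg, abs_mul, abs_of_pos Real.two_pi_pos] at h4
      have h6 : (1 : ℝ) ≤ |(n : ℝ)| := by exact_mod_cast Int.one_le_abs hn0
      nlinarith [Real.pi_gt_three]
    rw [h5] at h1
    have h7 : (e a + e b) - (e c + e d) = 0 := by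
      have := (div_eq_iff hM0.ne').1 h1
      simpa using this
    linarith
  refine ⟨isingParam E N κ g h J, z, hzgap, ?_⟩
  have hv' : ∀ i, (isingMatrix N g h J).map ((↑) : ℝ → ℂ) *ᵥ (fun a => (v i a : ℂ)) =
      (e i : ℂ) • fun a => (v i a : ℂ) := by
    intro i
    ext a
    have := congrArg ((↑) : ℝ → ℂ) (congrFun (hv i) a)
    simpa [mulVec, dotProduct] using this
  refine Matrix.charpoly_eq_prod_of_eigenvectors (v := fun i a => (v i a : ℂ)) ?_ ?_ ?_
  · intro a b hab
    rcases hzgap a a b b (by rw [hab]) with h | h <;> exact h.1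
  · intro i
    have hpiece : ∀ j : Fin E.n, NormedSpace.exp ((-Complex.I * (E.duration j 1 : ℂ)) •
        E.pieceHamiltonian (isingParam E N κ g h J) j) *ᵥ (fun a => (v i a : ℂ)) =
        (if j = E.first then z i else 1) • fun a => (v i a : ℂ) := by
      intro j
      by_cases hj : j = E.first
      · subst hj
        rw [if_pos rfl]
        refine Matrix.exp_mulVec_of_eigenvector ?_
        rw [pieceHamiltonian_isingParam_first E hx hz hzz, smul_mulVec, smul_mulVec, hv', smul_smul,
          smul_smul]
        congr 1
        have : (τ : ℂ) ≠ 0 := by exact_mod_cast hτ0.ne'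
        have : (M : ℂ) ≠ 0 := by exact_mod_cast hM0.ne'
        simp only [κ, ← hτ]
        push_cast
        field_simp
      · rw [if_neg hj, pieceHamiltonian_isingParam_of_ne E N κ g h J hj, smul_zero,
          NormedSpace.exp_zero, one_mulVec, one_smul]
    rw [Ensemble.floquetOperator, Ensemble.evolutionWithin, List.ofFn_eq_map,
      Matrix.list_reverse_prod_mulVec _ hpiece, ← List.ofFn_eq_map, List.prod_ofFn,
      Finset.prod_ite_eq' Finset.univ]
    simp
  · intro i h0
    have : v i = 0 := funext fun a => by simpa using congrFun h0 a
    have h1 := hvv i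
    rw [this] at h1
    simp at h1

end Floquet

end

/-! ### Genericity for almost all parameters -/

section

open Topology Matrix

/-- A continuous function which is analytic along lines and does not vanish identically is almost
everywhere nonzero. -/
theorem ae_ne_zero_of_analytic_on_lines {ι : Type*} [Fintype ι] {F : (ι → ℝ) → ℂ}
    (hc : Continuous F) (ha : ∀ p v, AnalyticOnNhd ℝ (fun t : ℝ => F (p + t • v)) Set.univ)
    {p₀ : ι → ℝ} (h0 : F p₀ ≠ 0) : ∀ᵐ p, F p ≠ 0 := by
  have hS : MeasurableSet {q : (ι → ℝ) × ℝ | F (p₀ + q.2 • q.1) = 0} :=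
    (isClosed_eq (hc.comp (by fun_prop)) continuous_const).measurableSet
  have hline : ∀ v, ∀ᵐ t : ℝ, F (p₀ + t • v) ≠ 0 := by
    intro v
    have h1 := (ha p₀ v).preimage_zero_mem_codiscrete (x := 0) (by simpa using h0)
    have h2 := ae_restrict_le_codiscreteWithin (μ := (volume : Measure ℝ)) MeasurableSet.univ h1
    rw [Measure.restrict_univ] at h2
    exact h2
  -- On each line through `p₀` the zeros are discrete, hence null. Fubini over (direction, time)
  -- produces one `t ≠ 0` for which almost every direction is good, and the homothety `v ↦ p₀ + t •
  -- v` reflects null sets.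
  have hprod : ∀ᵐ q : (ι → ℝ) × ℝ ∂(volume.prod volume), F (p₀ + q.2 • q.1) ≠ 0 := by
    rw [ae_iff]
    simp only [not_not]
    rw [Measure.measure_prod_null hS]
    exact Eventually.of_forall fun v => by simpa [ae_iff] using hline v
  have hswap : ∀ᵐ t : ℝ, ∀ᵐ v : ι → ℝ, F (p₀ + t • v) ≠ 0 :=
    Measure.ae_ae_of_ae_prod ((Measure.measurePreserving_swap).quasiMeasurePreserving.ae hprod)
  have hne : ∀ᵐ t : ℝ, t ≠ 0 := by simp [ae_iff]
  obtain ⟨t, ht, ht0⟩ := (hswap.and hne).exists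
  rw [ae_iff] at ht ⊢
  have h1 : {v : ι → ℝ | ¬ F (p₀ + t • v) ≠ 0} =
      (fun v : ι → ℝ => t • v) ⁻¹' ((fun v => p₀ + v) ⁻¹' {p | ¬ F p ≠ 0}) := rfl
  rw [h1, Measure.addHaar_preimage_smul _ ht0, measure_preimage_add] at ht
  refine (mul_eq_zero.1 ht).resolve_left ?_
  simp [ht0]

namespace Floquet

theorem Ensemble.pieceHamiltonian_add_smul (E : Ensemble) {N : ℕ} (p v : Param E.n N) (t : ℝ)
    (j : Fin E.n) : E.pieceHamiltonian (p + t • v) j =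
      E.pieceHamiltonian p j + t • E.pieceHamiltonian v j := by
  simp only [pieceHamiltonian, smul_add, Finset.smul_sum]
  rw [add_add_add_comm]
  simp only [← Finset.sum_add_distrib]
  congr 1
  · refine Finset.sum_congr rfl fun l _ => Finset.sum_congr rfl fun u _ => ?_
    split_ifs
    · ext a b; simp [field]; ring
    · simp
  · refine Finset.sum_congr rfl fun l _ => Finset.sum_congr rfl fun u _ =>
      Finset.sum_congr rfl fun u' _ => ?_
    split_ifs
    · ext a b; simp [coupling]; ring
    · simp

theorem Ensemble.continuous_pieceHamiltonian (E : Ensemble) (N : ℕ) (j : Fin E.n) :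
    Continuous fun p : Param E.n N => E.pieceHamiltonian p j := by
  unfold pieceHamiltonian field coupling
  refine Continuous.add (continuous_finsetSum _ fun l _ => continuous_finsetSum _ fun u _ => ?_)
    (continuous_finsetSum _ fun l _ => continuous_finsetSum _ fun u _ =>
      continuous_finsetSum _ fun u' _ => ?_)
  all_goals
    split_ifs
    · fun_prop
    · exact continuous_const

open scoped Matrix.Norms.Operator in
theorem _root_.Matrix.continuous_exp (ι : Type*) [Fintype ι] [DecidableEq ι] :
    Continuous fun A : Matrix ι ι ℂ => NormedSpace.exp A :=
  NormedSpace.exp_continuous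

theorem Ensemble.continuous_floquetOperator (E : Ensemble) (N : ℕ) :
    Continuous fun p : Param E.n N => E.floquetOperator p := by
  simp only [floquetOperator, evolutionWithin, List.ofFn_eq_map, ← List.map_reverse]
  refine continuous_list_prod _ fun j _ => (Matrix.continuous_exp _).comp ?_
  have := E.continuous_pieceHamiltonian N j
  fun_prop

open scoped Matrix.Norms.Operator in
theorem Ensemble.analyticAt_floquetOperator (E : Ensemble) {N : ℕ} (p v : Param E.n N) (t : ℝ)
    (a b : Basis (Fin N)) : AnalyticAt ℝ (fun t : ℝ => E.floquetOperator (p + t • v) a b) t := by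
  have hfac : ∀ j : Fin E.n, AnalyticAt ℝ (fun t : ℝ => NormedSpace.exp
      ((-Complex.I * (E.duration j 1 : ℂ)) • E.pieceHamiltonian (p + t • v) j)) t := by
    intro j
    simp only [pieceHamiltonian_add_smul]
    refine (NormedSpace.exp_analytic (𝕂 := ℝ) _).comp ?_
    exact AnalyticAt.fun_const_smul (analyticAt_const.add (analyticAt_id.smul analyticAt_const))
  have hprod : ∀ l : List (Fin E.n), AnalyticAt ℝ (fun t : ℝ => (l.map fun j => NormedSpace.exp
      ((-Complex.I * (E.duration j 1 : ℂ)) • E.pieceHamiltonian (p + t • v) j)).prod) t := by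
    intro l
    induction l with
    | nil => simpa using analyticAt_const
    | cons j l ih =>
      simp only [List.map_cons, List.prod_cons]
      exact (hfac j).mul ih
  have h := hprod (List.finRange E.n).reverse
  let L : Matrix (Basis (Fin N)) (Basis (Fin N)) ℂ →L[ℝ] ℂ :=
    LinearMap.toContinuousLinearMap
      { toFun := fun A => A a b, map_add' := fun _ _ => rfl, map_smul' := fun _ _ => rfl }
  have h2 := (L.analyticAt _).comp h
  refine h2.congr (Eventually.of_forall fun t => ?_)
  simp only [floquetOperator, evolutionWithin, List.ofFn_eq_map, ← List.map_reverse]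
  rfl

/-- The polynomial `R`, evaluated at the Floquet operator, is continuous, analytic along lines and
nonzero at the Ising example. -/
theorem Ensemble.ae_hasGenericProducts (E : Ensemble) (hx : E.α E.first Axis.x = true)
    (hz : E.α E.first Axis.z = true) (hzz : E.γ E.first Axis.z Axis.z = true) (N : ℕ) :
    ∀ᵐ p : Param E.n (N + 1), ∃ z : Basis (Fin (N + 1)) → ℂ, HasGenericProducts z ∧
      (E.floquetOperator p).charpoly = ∏ i, (Polynomial.X - Polynomial.C (z i)) := by
  obtain ⟨R, hR⟩ := exists_mvPolynomial_hasGenericProducts (Basis (Fin (N + 1)))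
  obtain ⟨p₀, z₀, hz₀, hp₀⟩ := exists_floquetOperator_hasGenericProducts E hx hz hzz N
  have h := ae_ne_zero_of_analytic_on_lines
    (F := fun p : Param E.n (N + 1) =>
      MvPolynomial.aeval (fun q : Basis (Fin (N + 1)) × Basis (Fin (N + 1)) =>
        E.floquetOperator p q.1 q.2) R) ?_ ?_ ((hR _ _ hp₀).2 hz₀)
  · filter_upwards [h] with p hp
    obtain ⟨z, hz⟩ := Matrix.exists_charpoly_eq_prod (E.floquetOperator p)
    exact ⟨z, (hR _ _ hz).1 hp, hz⟩
  · have h1 := E.continuous_floquetOperator (N + 1)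
    refine (MvPolynomial.continuous_eval R).comp (continuous_pi fun q => ?_)
    exact (continuous_apply q.2).comp ((continuous_apply q.1).comp h1)
  · intro p v t _
    have := AnalyticAt.aeval_mvPolynomial (𝕜 := ℝ) (z := t)
      (f := fun t (q : Basis (Fin (N + 1)) × Basis (Fin (N + 1))) =>
        E.floquetOperator (p + t • v) q.1 q.2)
      (fun q => E.analyticAt_floquetOperator p v t q.1 q.2) R
    exact this

end Floquet

end

/-! ### Fourth moments of Haar-random product states -/

open scoped Pointwise in
/-- A linear isometry preserves the surface measure of the unit sphere. -/
theorem MeasureTheory.Measure.toSphere_map_linearIsometryEquiv {E : Type*} [NormedAddCommGroup E]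
    [InnerProductSpace ℝ E] [FiniteDimensional ℝ E] [MeasurableSpace E] [BorelSpace E]
    (L : E ≃ₗᵢ[ℝ] E) {f : Metric.sphere (0 : E) 1 → Metric.sphere (0 : E) 1}
    (hf : ∀ x, (f x : E) = L x) :
    MeasurePreserving f (volume : Measure E).toSphere (volume : Measure E).toSphere := by
  have hfm : Measurable f := by
    refine Measurable.subtype_mk (p := fun x => x ∈ Metric.sphere (0 : E) 1)
      (f := fun x => (f x : E)) ?_
    simp only [hf]
    exact L.continuous.measurable.comp measurable_subtype_coe
  refine ⟨hfm, Measure.ext fun s hs => ?_⟩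
  rw [Measure.map_apply hfm hs, Measure.toSphere_apply' _ (hfm hs), Measure.toSphere_apply' _ hs]
  congr 1
  have himg : ((↑) '' (f ⁻¹' s) : Set E) = L ⁻¹' ((↑) '' s) := by
    ext x
    constructor
    · rintro ⟨y, hy, rfl⟩
      exact ⟨f y, hy, hf y⟩
    · rintro ⟨y, hy, hyx⟩
      have hx : x ∈ Metric.sphere (0 : E) 1 := by
        have h1 : ‖(y : E)‖ = 1 := by simp
        rw [mem_sphere_zero_iff_norm, ← L.norm_map, ← hyx, h1]
      refine ⟨⟨x, hx⟩, ?_, rfl⟩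
      have : f ⟨x, hx⟩ = y := Subtype.ext (by rw [hf, hyx])
      rwa [Set.mem_preimage, this]
  have hsm : Set.Ioo (0 : ℝ) 1 • (L ⁻¹' ((↑) '' s) : Set E) =
      L ⁻¹' (Set.Ioo (0 : ℝ) 1 • ((↑) '' s : Set E)) := by
    ext x
    simp only [Set.mem_smul, Set.mem_preimage]
    constructor
    · rintro ⟨r, hr, y, hy, rfl⟩
      exact ⟨r, hr, L y, hy, by simp⟩
    · rintro ⟨r, hr, y, hy, hyx⟩
      exact ⟨r, hr, L.symm y, by simpa using hy, by rw [← L.symm.map_smul, hyx]; simp⟩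
  rw [himg, hsm]
  exact MeasurePreserving.measure_preimage_equiv (f := L.toMeasurableEquiv) L.measurePreserving _

namespace Floquet

theorem norm_sq_add_norm_sq (φ : QubitState) :
    ‖(φ : EuclideanSpace ℂ (Fin 2)) 0‖ ^ 2 + ‖(φ : EuclideanSpace ℂ (Fin 2)) 1‖ ^ 2 = 1 := by
  have h1 : ‖(φ : EuclideanSpace ℂ (Fin 2))‖ = 1 := by simp
  have h2 := EuclideanSpace.norm_sq_eq (φ : EuclideanSpace ℂ (Fin 2))
  rw [h1, Fin.sum_univ_two] at h2
  linarith

theorem integrable_haarQubit {f : QubitState → ℝ} (hf : Continuous f) :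
    Integrable f haarQubit :=
  hf.integrable_of_hasCompactSupport (HasCompactSupport.of_compactSpace f)

/-- Invariance of the Haar measure under linear isometries. -/
theorem integral_haarQubit_comp (L : EuclideanSpace ℂ (Fin 2) →ₗ[ℝ] EuclideanSpace ℂ (Fin 2))
    (hL : ∀ x, ‖L x‖ = ‖x‖) (F : EuclideanSpace ℂ (Fin 2) → ℝ) (hF : Continuous F) :
    ∫ φ : QubitState, F (L φ) ∂haarQubit = ∫ φ : QubitState, F φ ∂haarQubit := by
  let L' : EuclideanSpace ℂ (Fin 2) ≃ₗᵢ[ℝ] EuclideanSpace ℂ (Fin 2) :=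
    LinearIsometry.toLinearIsometryEquiv ⟨L, hL⟩ rfl
  let f : QubitState → QubitState := fun φ => ⟨L φ, by
    have h1 : ‖(φ : EuclideanSpace ℂ (Fin 2))‖ = 1 := by simp
    rw [mem_sphere_zero_iff_norm, hL, h1]⟩
  have hf := (Measure.toSphere_map_linearIsometryEquiv L' (f := f) fun _ => rfl).smul_measure
    ((volume : Measure (EuclideanSpace ℂ (Fin 2))).toSphere Set.univ)⁻¹
  have h := integral_map (μ := haarQubit) hf.measurable.aemeasurable
    (f := fun φ : QubitState => F φ) (hF.comp continuous_subtype_val).aestronglyMeasurable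
  rw [show Measure.map f haarQubit = haarQubit from hf.map_eq] at h
  exact h.symm

/-- The real linear map given by a complex `2 × 2` matrix. -/
def qubitMap (a b c d : ℂ) : EuclideanSpace ℂ (Fin 2) →ₗ[ℝ] EuclideanSpace ℂ (Fin 2) where
  toFun x := !₂[a * x 0 + b * x 1, c * x 0 + d * x 1]
  map_add' x y := by
    ext i; fin_cases i <;> simp <;> ring
  map_smul' r x := by
    ext i; fin_cases i <;> simp <;> ring

/-- Averaging over the four powers of `I` removes every phase-dependent cross term of the quartic;
it replaces an integral over the relative phase. -/
theorem normSq_I_pow_average (x y : ℂ) :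
    ‖x + y‖ ^ 4 + ‖x + Complex.I * y‖ ^ 4 + ‖x - y‖ ^ 4 + ‖x - Complex.I * y‖ ^ 4 =
      4 * (‖x‖ ^ 4 + ‖y‖ ^ 4 + 4 * (‖x‖ ^ 2 * ‖y‖ ^ 2)) := by
  have h : ∀ z : ℂ, ‖z‖ ^ 4 = (z.re ^ 2 + z.im ^ 2) ^ 2 := fun z => by
    rw [show ‖z‖ ^ 4 = (‖z‖ ^ 2) ^ 2 by ring, Complex.sq_norm, Complex.normSq_apply]; ring
  simp only [h, Complex.sq_norm, Complex.normSq_apply]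
  simp
  ring

theorem integral_phase (k : ℂ) (hk : ‖k‖ = 1) (α β : ℂ) :
    ∫ φ : QubitState, ‖α * (φ : EuclideanSpace ℂ (Fin 2)) 0 +
        k * (β * (φ : EuclideanSpace ℂ (Fin 2)) 1)‖ ^ 4 ∂haarQubit =
      ∫ φ : QubitState, ‖α * (φ : EuclideanSpace ℂ (Fin 2)) 0 +
        β * (φ : EuclideanSpace ℂ (Fin 2)) 1‖ ^ 4 ∂haarQubit := by
  have h := integral_haarQubit_comp (qubitMap 1 0 0 k) (fun x => ?_)
    (fun x => ‖α * x 0 + β * x 1‖ ^ 4) (by fun_prop)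
  · rw [← h]
    congr 1
    ext φ
    simp [qubitMap]
    ring_nf
  · rw [EuclideanSpace.norm_eq, EuclideanSpace.norm_eq]
    simp [qubitMap, hk]

/-- By `integral_phase` each of the four relative phases gives the same integral, so the integrand
may be replaced by its phase average. -/
theorem integral_norm_pow_four_aux (α β : ℂ) :
    ∫ φ : QubitState, ‖α * (φ : EuclideanSpace ℂ (Fin 2)) 0 +
        β * (φ : EuclideanSpace ℂ (Fin 2)) 1‖ ^ 4 ∂haarQubit =
      ‖α‖ ^ 4 * (∫ φ : QubitState, ‖(φ : EuclideanSpace ℂ (Fin 2)) 0‖ ^ 4 ∂haarQubit) +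
      ‖β‖ ^ 4 * (∫ φ : QubitState, ‖(φ : EuclideanSpace ℂ (Fin 2)) 1‖ ^ 4 ∂haarQubit) +
      4 * (‖α‖ ^ 2 * ‖β‖ ^ 2) * (∫ φ : QubitState, ‖(φ : EuclideanSpace ℂ (Fin 2)) 0‖ ^ 2 *
        ‖(φ : EuclideanSpace ℂ (Fin 2)) 1‖ ^ 2 ∂haarQubit) := by
  have h1 := integral_phase Complex.I (by simp) α β
  have h2 := integral_phase (-1) (by simp) α β
  have h3 := integral_phase (-Complex.I) (by simp) α β
  have i0 : ∀ k : ℂ, Integrable (fun φ : QubitState => ‖α * (φ : EuclideanSpace ℂ (Fin 2)) 0 +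
      k * (β * (φ : EuclideanSpace ℂ (Fin 2)) 1)‖ ^ 4) haarQubit := fun k =>
    integrable_haarQubit (by fun_prop)
  have i1 : Integrable (fun φ : QubitState => ‖(φ : EuclideanSpace ℂ (Fin 2)) 0‖ ^ 4) haarQubit :=
    integrable_haarQubit (by fun_prop)
  have i2 : Integrable (fun φ : QubitState => ‖(φ : EuclideanSpace ℂ (Fin 2)) 1‖ ^ 4) haarQubit :=
    integrable_haarQubit (by fun_prop)
  have i3 : Integrable (fun φ : QubitState => ‖(φ : EuclideanSpace ℂ (Fin 2)) 0‖ ^ 2 *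
      ‖(φ : EuclideanSpace ℂ (Fin 2)) 1‖ ^ 2) haarQubit := integrable_haarQubit (by fun_prop)
  have h4 : ∫ φ : QubitState, (‖α * (φ : EuclideanSpace ℂ (Fin 2)) 0 +
        1 * (β * (φ : EuclideanSpace ℂ (Fin 2)) 1)‖ ^ 4 +
      ‖α * (φ : EuclideanSpace ℂ (Fin 2)) 0 +
        Complex.I * (β * (φ : EuclideanSpace ℂ (Fin 2)) 1)‖ ^ 4 +
      ‖α * (φ : EuclideanSpace ℂ (Fin 2)) 0 +
        (-1) * (β * (φ : EuclideanSpace ℂ (Fin 2)) 1)‖ ^ 4 +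
      ‖α * (φ : EuclideanSpace ℂ (Fin 2)) 0 +
        (-Complex.I) * (β * (φ : EuclideanSpace ℂ (Fin 2)) 1)‖ ^ 4) ∂haarQubit =
      ∫ φ : QubitState, 4 * (‖α‖ ^ 4 * ‖(φ : EuclideanSpace ℂ (Fin 2)) 0‖ ^ 4 +
        ‖β‖ ^ 4 * ‖(φ : EuclideanSpace ℂ (Fin 2)) 1‖ ^ 4 +
        4 * (‖α‖ ^ 2 * ‖β‖ ^ 2) * (‖(φ : EuclideanSpace ℂ (Fin 2)) 0‖ ^ 2 *
          ‖(φ : EuclideanSpace ℂ (Fin 2)) 1‖ ^ 2)) ∂haarQubit := by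
    congr 1
    ext φ
    have := normSq_I_pow_average (α * (φ : EuclideanSpace ℂ (Fin 2)) 0)
      (β * (φ : EuclideanSpace ℂ (Fin 2)) 1)
    rw [one_mul, neg_one_mul, neg_mul, ← sub_eq_add_neg, ← sub_eq_add_neg, this]
    simp only [norm_mul]
    ring
  rw [integral_add (((i0 _).fun_add (i0 _)).fun_add (i0 _)) (i0 _),
    integral_add ((i0 _).fun_add (i0 _)) (i0 _), integral_add (i0 _) (i0 _), h1, h2, h3,
    integral_const_mul, integral_add ((i1.const_mul _).fun_add (i2.const_mul _)) (i3.const_mul _),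
    integral_add (i1.const_mul _) (i2.const_mul _), integral_const_mul, integral_const_mul,
    integral_const_mul] at h4
  simp only [one_mul] at h4
  linarith

/-- The fourth moments of a Haar-random qubit state. -/
theorem integral_norm_pow_four (α β : ℂ) :
    ∫ φ : QubitState, ‖α * (φ : EuclideanSpace ℂ (Fin 2)) 0 +
        β * (φ : EuclideanSpace ℂ (Fin 2)) 1‖ ^ 4 ∂haarQubit =
      (‖α‖ ^ 2 + ‖β‖ ^ 2) ^ 2 / 3 := by
  have i1 : Integrable (fun φ : QubitState => ‖(φ : EuclideanSpace ℂ (Fin 2)) 0‖ ^ 4) haarQubit :=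
    integrable_haarQubit (by fun_prop)
  have i2 : Integrable (fun φ : QubitState => ‖(φ : EuclideanSpace ℂ (Fin 2)) 1‖ ^ 4) haarQubit :=
    integrable_haarQubit (by fun_prop)
  have i3 : Integrable (fun φ : QubitState => ‖(φ : EuclideanSpace ℂ (Fin 2)) 0‖ ^ 2 *
      ‖(φ : EuclideanSpace ℂ (Fin 2)) 1‖ ^ 2) haarQubit := integrable_haarQubit (by fun_prop)
  rw [integral_norm_pow_four_aux]
  set A := ∫ φ : QubitState, ‖(φ : EuclideanSpace ℂ (Fin 2)) 0‖ ^ 4 ∂haarQubit with hA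
  set A' := ∫ φ : QubitState, ‖(φ : EuclideanSpace ℂ (Fin 2)) 1‖ ^ 4 ∂haarQubit with hA'
  set B := ∫ φ : QubitState, ‖(φ : EuclideanSpace ℂ (Fin 2)) 0‖ ^ 2 *
        ‖(φ : EuclideanSpace ℂ (Fin 2)) 1‖ ^ 2 ∂haarQubit with hB
  -- Normalization is one linear equation for the three moments. Invariance under the Hadamard
  -- rotation gives two more, and together they force `A = A' = 1/3`, `B = 1/6`.
  have htot : A + A' + 2 * B = 1 := by
    rw [hA, hA', hB, ← integral_const_mul, ← integral_add i1 i2,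
      ← integral_add (i1.fun_add i2) (i3.const_mul 2)]
    have : ∀ φ : QubitState, (‖(φ : EuclideanSpace ℂ (Fin 2)) 0‖ ^ 4 +
        ‖(φ : EuclideanSpace ℂ (Fin 2)) 1‖ ^ 4) + 2 * (‖(φ : EuclideanSpace ℂ (Fin 2)) 0‖ ^ 2 *
          ‖(φ : EuclideanSpace ℂ (Fin 2)) 1‖ ^ 2) = 1 := fun φ => by
      have := norm_sq_add_norm_sq φ
      linear_combination (‖(φ : EuclideanSpace ℂ (Fin 2)) 0‖ ^ 2 +
        ‖(φ : EuclideanSpace ℂ (Fin 2)) 1‖ ^ 2 + 1) * this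
    simp [this]
  -- the Hadamard rotation
  set c : ℂ := (((√2)⁻¹ : ℝ) : ℂ) with hc
  have hc2 : ‖c‖ ^ 2 = 1 / 2 := by
    rw [hc, Complex.norm_real, Real.norm_of_nonneg (by positivity), inv_pow, Real.sq_sqrt (by simp)]
    norm_num
  have hc4 : ‖c‖ ^ 4 = 1 / 4 := by
    rw [show ‖c‖ ^ 4 = (‖c‖ ^ 2) ^ 2 by ring, hc2]; norm_num
  have hiso : ∀ x, ‖qubitMap c c c (-c) x‖ = ‖x‖ := fun x => by
    have hpar := parallelogram_law_with_norm ℝ (x 0) (x 1)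
    rw [EuclideanSpace.norm_eq, EuclideanSpace.norm_eq]
    rw [Fin.sum_univ_two, Fin.sum_univ_two]
    have e1 : c * x 0 + c * x 1 = c * (x 0 + x 1) := by ring
    have e2 : c * x 0 + -c * x 1 = c * (x 0 - x 1) := by ring
    change √(‖c * x 0 + c * x 1‖ ^ 2 + ‖c * x 0 + -c * x 1‖ ^ 2) = _
    rw [e1, e2, norm_mul, norm_mul, mul_pow, mul_pow, hc2]
    congr 1
    linarith
  have hH0 := integral_haarQubit_comp _ hiso (fun x => ‖x 0‖ ^ 4) (by fun_prop)
  have hH1 := integral_haarQubit_comp _ hiso (fun x => ‖x 1‖ ^ 4) (by fun_prop)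
  have e0 := integral_norm_pow_four_aux c c
  have e1 := integral_norm_pow_four_aux c (-c)
  simp only [← hA, ← hA', ← hB, norm_neg, hc4, hc2] at e0 e1
  have g0 : A = 1 / 4 * A + 1 / 4 * A' + 4 * (1 / 2 * (1 / 2)) * B := by
    rw [← e0]; exact hH0.symm
  have g1 : A' = 1 / 4 * A + 1 / 4 * A' + 4 * (1 / 2 * (1 / 2)) * B := by
    rw [← e1]; exact hH1.symm
  have r1 : A = 1 / 3 := by linarith
  have r2 : A' = 1 / 3 := by linarith
  have r3 : B = 1 / 6 := by linarith
  rw [r1, r2, r3]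
  ring

theorem integrable_haarProduct {N : ℕ} {f : (Fin N → QubitState) → ℝ} (hf : Continuous f) :
    Integrable f (haarProduct N) := by
  unfold haarProduct
  exact hf.integrable_of_hasCompactSupport (HasCompactSupport.of_compactSpace f)

/-- The overlap of a vector with a product state. -/
def overlap {N : ℕ} (v : Basis (Fin N) → ℂ) (φ : Fin N → QubitState) : ℂ :=
  ∑ a, v a * productState φ a

theorem continuous_overlap {N : ℕ} (v : Basis (Fin N) → ℂ) : Continuous (overlap v) := by
  unfold overlap productState
  fun_prop

theorem overlap_cons {N : ℕ} (v : Basis (Fin (N + 1)) → ℂ) (φ₀ : QubitState)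
    (φ : Fin N → QubitState) : overlap v (Fin.cons φ₀ φ) =
      overlap (fun a => v (Fin.cons 0 a)) φ * (φ₀ : EuclideanSpace ℂ (Fin 2)) 0 +
      overlap (fun a => v (Fin.cons 1 a)) φ * (φ₀ : EuclideanSpace ℂ (Fin 2)) 1 := by
  simp only [overlap, productState]
  rw [← (Fin.consEquiv fun _ => Fin 2).sum_comp, Fintype.sum_prod_type, Fin.sum_univ_two,
    Finset.sum_mul, Finset.sum_mul]
  congr 1 <;>
  · refine Finset.sum_congr rfl fun a _ => ?_
    simp [Fin.consEquiv, Fin.prod_univ_succ]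
    ring

theorem sum_norm_sq_cons {N : ℕ} (v : Basis (Fin (N + 1)) → ℂ) :
    ∑ a, ‖v a‖ ^ 2 = ∑ a : Basis (Fin N), ‖v (Fin.cons 0 a)‖ ^ 2 +
      ∑ a : Basis (Fin N), ‖v (Fin.cons 1 a)‖ ^ 2 := by
  rw [← (Fin.consEquiv fun _ => Fin 2).sum_comp, Fintype.sum_prod_type, Fin.sum_univ_two]
  rfl

/-- The fourth moment of the overlap with a Haar-random product state. -/
theorem integral_overlap_pow_four_le {N : ℕ} (v : Basis (Fin N) → ℂ) :
    ∫ φ, ‖overlap v φ‖ ^ 4 ∂haarProduct N ≤ (1 / 3) ^ N * (∑ a, ‖v a‖ ^ 2) ^ 2 := by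
  induction N with
  | zero =>
    have h : ∀ φ, overlap v φ = v default := fun φ => by
      rw [overlap, Fintype.sum_unique]
      simp only [productState, Finset.univ_eq_empty, Finset.prod_empty, mul_one]
      exact congrArg v (Subsingleton.elim _ _)
    have h2 : ∑ a, ‖v a‖ ^ 2 = ‖v default‖ ^ 2 := by
      rw [Fintype.sum_unique]
      exact congrArg (fun a => ‖v a‖ ^ 2) (Subsingleton.elim _ _)
    have : IsProbabilityMeasure (haarProduct 0) := by unfold haarProduct; infer_instance
    rw [h2]
    simp only [h, integral_const, probReal_univ, one_smul, pow_zero, one_mul]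
    exact le_of_eq (by ring)
  | succ N ih =>
    set v0 : Basis (Fin N) → ℂ := fun a => v (Fin.cons 0 a) with hv0
    set v1 : Basis (Fin N) → ℂ := fun a => v (Fin.cons 1 a) with hv1
    set A := ∑ a, ‖v0 a‖ ^ 2 with hA
    set B := ∑ a, ‖v1 a‖ ^ 2 with hB
    have hA0 : 0 ≤ A := Finset.sum_nonneg fun _ _ => by positivity
    have hB0 : 0 ≤ B := Finset.sum_nonneg fun _ _ => by positivity
    have hmp := measurePreserving_piFinSuccAbove (fun _ : Fin (N + 1) => haarQubit) 0
    -- Fubini: the first qubit is integrated out exactly, conditionally on the others.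
    have hsplit : ∫ φ, ‖overlap v φ‖ ^ 4 ∂haarProduct (N + 1) =
        ∫ φ, (‖overlap v0 φ‖ ^ 2 + ‖overlap v1 φ‖ ^ 2) ^ 2 / 3 ∂haarProduct N := by
      have h1 := hmp.symm.integral_comp' (g := fun φ => ‖overlap v φ‖ ^ 4)
      rw [haarProduct, ← h1, integral_prod_symm]
      · refine integral_congr_ae (Eventually.of_forall fun φ => ?_)
        simp only [← integral_norm_pow_four]
        refine integral_congr_ae (Eventually.of_forall fun φ₀ => ?_)
        simp only
        rw [← overlap_cons]
        have : (MeasurableEquiv.piFinSuccAbove (fun _ : Fin (N + 1) => QubitState) 0).symm (φ₀, φ) =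
            Fin.cons φ₀ φ := Fin.insertNth_zero' φ₀ φ
        rw [this]
      · have hc : Continuous fun q : QubitState × (Fin N → QubitState) =>
            ‖overlap v (Fin.cons q.1 q.2)‖ ^ 4 := by
          simp only [overlap_cons]
          have h0 := continuous_overlap v0
          have h1 := continuous_overlap v1
          fun_prop
        refine (hc.integrable_of_hasCompactSupport (HasCompactSupport.of_compactSpace _)).congr
          (Eventually.of_forall fun q => ?_)
        have : (MeasurableEquiv.piFinSuccAbove (fun _ : Fin (N + 1) => QubitState) 0).symm q =
            Fin.cons q.1 q.2 := Fin.insertNth_zero' q.1 q.2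
        simp only [this]
    rw [hsplit, sum_norm_sq_cons, ← hA, ← hB]
    have c0 := continuous_overlap v0
    have c1 := continuous_overlap v1
    have i0 : Integrable (fun φ => ‖overlap v0 φ‖ ^ 4) (haarProduct N) :=
      integrable_haarProduct (by fun_prop)
    have i1 : Integrable (fun φ => ‖overlap v1 φ‖ ^ 4) (haarProduct N) :=
      integrable_haarProduct (by fun_prop)
    have hzero : ∀ w : Basis (Fin N) → ℂ, ∑ a, ‖w a‖ ^ 2 = 0 → ∀ φ, overlap w φ = 0 := by
      intro w hw φ
      rw [Finset.sum_eq_zero_iff_of_nonneg fun _ _ => by positivity] at hw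
      refine Finset.sum_eq_zero fun a ha => ?_
      have : w a = 0 := by simpa using hw a ha
      rw [this, zero_mul]
    -- The weights `1 / A` and `1 / B` used below degenerate when one half of `v` vanishes; its
    -- overlap is then identically zero.
    rcases hA0.eq_or_lt with hA0 | hA0
    · simp only [hzero v0 hA0.symm]
      have : ∀ φ, ((‖(0 : ℂ)‖ ^ 2 + ‖overlap v1 φ‖ ^ 2) ^ 2 / 3) =
          1 / 3 * ‖overlap v1 φ‖ ^ 4 := fun φ => by simp; ring
      simp only [this, integral_const_mul]
      rw [← hA0, zero_add, pow_succ', mul_assoc]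
      exact mul_le_mul_of_nonneg_left (ih v1) (by norm_num)
    rcases hB0.eq_or_lt with hB0 | hB0
    · simp only [hzero v1 hB0.symm]
      have : ∀ φ, ((‖overlap v0 φ‖ ^ 2 + ‖(0 : ℂ)‖ ^ 2) ^ 2 / 3) =
          1 / 3 * ‖overlap v0 φ‖ ^ 4 := fun φ => by simp; ring
      simp only [this, integral_const_mul]
      rw [← hB0, add_zero, pow_succ', mul_assoc]
      exact mul_le_mul_of_nonneg_left (ih v0) (by norm_num)
    -- Weighted Cauchy–Schwarz, `(x² + y²)² ≤ (A + B) * (x⁴ / A + y⁴ / B)`, avoids mixed moments and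
    -- closes the induction with no loss in the constant.
    calc ∫ φ, (‖overlap v0 φ‖ ^ 2 + ‖overlap v1 φ‖ ^ 2) ^ 2 / 3 ∂haarProduct N
        ≤ ∫ φ, ((A + B) / (3 * A) * ‖overlap v0 φ‖ ^ 4 +
            (A + B) / (3 * B) * ‖overlap v1 φ‖ ^ 4) ∂haarProduct N := by
          refine integral_mono (integrable_haarProduct (by fun_prop))
            ((i0.const_mul _).add (i1.const_mul _)) fun φ => ?_
          simp only
          generalize ‖overlap v0 φ‖ = x
          generalize ‖overlap v1 φ‖ = y
          have h : (A + B) / (3 * A) * x ^ 4 + (A + B) / (3 * B) * y ^ 4 -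
              (x ^ 2 + y ^ 2) ^ 2 / 3 = (B * x ^ 2 - A * y ^ 2) ^ 2 / (3 * A * B) := by
            field_simp
            ring
          have h2 : 0 ≤ (B * x ^ 2 - A * y ^ 2) ^ 2 / (3 * A * B) := by positivity
          linarith
      _ = (A + B) / (3 * A) * (∫ φ, ‖overlap v0 φ‖ ^ 4 ∂haarProduct N) +
            (A + B) / (3 * B) * (∫ φ, ‖overlap v1 φ‖ ^ 4 ∂haarProduct N) := by
          rw [integral_add (i0.const_mul _) (i1.const_mul _), integral_const_mul,
            integral_const_mul]
      _ ≤ (A + B) / (3 * A) * ((1 / 3) ^ N * A ^ 2) + (A + B) / (3 * B) * ((1 / 3) ^ N * B ^ 2) := by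
          gcongr
          · exact ih v0
          · exact ih v1
      _ = (1 / 3) ^ (N + 1) * (A + B) ^ 2 := by
          rw [pow_succ (1 / 3 : ℝ) N]
          generalize (1 / 3 : ℝ) ^ N = K
          field_simp

end Floquet

/-! ### Time averages and reduced transition matrices -/

section

open Matrix

theorem norm_geom_sum_le {r : ℂ} (hr : ‖r‖ = 1) (h1 : r ≠ 1) (M : ℕ) :
    ‖∑ m ∈ Finset.range M, r ^ m‖ ≤ 2 / ‖r - 1‖ := by
  rw [geom_sum_eq h1, norm_div]
  gcongr
  calc ‖r ^ M - 1‖ ≤ ‖r ^ M‖ + ‖(1 : ℂ)‖ := norm_sub_le _ _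
    _ = 2 := by rw [norm_pow, hr]; norm_num

/-- Orthogonality of distinct characters of `ℕ` on average, with an error that is uniform in the
coefficients. -/
theorem exists_sum_norm_sq_le {κ : Type*} [Fintype κ] {ζ : κ → ℂ} (hζ : ∀ k, ‖ζ k‖ = 1)
    (hinj : Function.Injective ζ) : ∃ C : ℝ, 0 ≤ C ∧ ∀ x : κ → ℂ, (∀ k, ‖x k‖ ≤ 1) → ∀ M : ℕ,
      ∑ m ∈ Finset.range M, ‖∑ k, x k * ζ k ^ m‖ ^ 2 ≤ M * ∑ k, ‖x k‖ ^ 2 + C := by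
  classical
  -- The terms `k = l` are `2 / 0 = 0` and add nothing; the others bound the geometric sums of
  -- distinct frequencies.
  refine ⟨∑ k, ∑ l, 2 / ‖ζ k * star (ζ l) - 1‖, by positivity, fun x hx M => ?_⟩
  have hexp : ((∑ m ∈ Finset.range M, ‖∑ k, x k * ζ k ^ m‖ ^ 2 : ℝ) : ℂ) =
      ∑ k, ∑ l, x k * star (x l) * ∑ m ∈ Finset.range M, (ζ k * star (ζ l)) ^ m := by
    push_cast
    simp only [← Complex.mul_conj', map_sum, map_mul, map_pow, Finset.sum_mul_sum]
    simp only [Finset.mul_sum]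
    rw [Finset.sum_comm]
    refine Finset.sum_congr rfl fun k _ => ?_
    rw [Finset.sum_comm]
    refine Finset.sum_congr rfl fun l _ => Finset.sum_congr rfl fun m _ => ?_
    simp only [mul_pow, Complex.star_def]
    ring
  have hnorm : ∑ m ∈ Finset.range M, ‖∑ k, x k * ζ k ^ m‖ ^ 2 =
      ‖((∑ m ∈ Finset.range M, ‖∑ k, x k * ζ k ^ m‖ ^ 2 : ℝ) : ℂ)‖ := by
    rw [Complex.norm_real, Real.norm_of_nonneg (by positivity)]
  rw [hnorm, hexp]
  have hterm : ∀ k l, ‖x k * star (x l) * ∑ m ∈ Finset.range M, (ζ k * star (ζ l)) ^ m‖ ≤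
      (if k = l then M * ‖x k‖ ^ 2 else 0) + 2 / ‖ζ k * star (ζ l) - 1‖ := by
    intro k l
    have hu : ζ l * star (ζ l) = 1 := by
      rw [Complex.star_def, Complex.mul_conj', hζ]; simp
    by_cases hkl : k = l
    · subst hkl
      rw [if_pos rfl, hu]
      simp only [one_pow, Finset.sum_const, Finset.card_range, nsmul_eq_mul, mul_one, norm_mul,
        norm_star, Complex.norm_natCast]
      have : 0 ≤ 2 / ‖(1 : ℂ) - 1‖ := by positivity
      nlinarith
    · rw [if_neg hkl, zero_add, norm_mul, norm_mul, norm_star]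
      have hne : ζ k * star (ζ l) ≠ 1 := by
        intro h
        refine hkl (hinj ?_)
        calc ζ k = ζ k * (ζ l * star (ζ l)) := by rw [hu, mul_one]
          _ = ζ l * (ζ k * star (ζ l)) := by ring
          _ = ζ l := by rw [h, mul_one]
      have hg := norm_geom_sum_le (r := ζ k * star (ζ l)) (by rw [norm_mul, norm_star, hζ, hζ, one_mul])
        hne M
      have hxx : ‖x k‖ * ‖x l‖ ≤ 1 := mul_le_one₀ (hx k) (norm_nonneg _) (hx l)
      calc _ ≤ 1 * ‖∑ m ∈ Finset.range M, (ζ k * star (ζ l)) ^ m‖ := by gcongr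
        _ ≤ _ := by rw [one_mul]; exact hg
  calc _ ≤ ∑ k, ∑ l, ‖x k * star (x l) * ∑ m ∈ Finset.range M, (ζ k * star (ζ l)) ^ m‖ :=
        (norm_sum_le _ _).trans (Finset.sum_le_sum fun k _ => norm_sum_le _ _)
    _ ≤ ∑ k, ∑ l, ((if k = l then M * ‖x k‖ ^ 2 else 0) + 2 / ‖ζ k * star (ζ l) - 1‖) :=
        Finset.sum_le_sum fun k _ => Finset.sum_le_sum fun l _ => hterm k l
    _ = _ := by
        simp only [Finset.sum_add_distrib, Finset.sum_ite_eq, Finset.mem_univ, if_true,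
          Finset.mul_sum]

namespace Floquet

/-- Cauchy–Schwarz over the singular values, whose squares sum to the trace of `Aᴴ * A`. -/
theorem traceNorm_sq_le {d : Type} [Fintype d] [DecidableEq d] (A : Matrix d d ℂ) :
    traceNorm A ^ 2 ≤ Fintype.card d * ∑ a, ∑ b, ‖A a b‖ ^ 2 := by
  have hpsd : (Aᴴ * A).PosSemidef := Matrix.posSemidef_conjTranspose_mul_self A
  have htr : ∑ i, (Matrix.isHermitian_conjTranspose_mul_self A).eigenvalues i =
      ∑ a, ∑ b, ‖A a b‖ ^ 2 := by
    have h := (Matrix.isHermitian_conjTranspose_mul_self A).trace_eq_sum_eigenvalues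
    have h2 : (Aᴴ * A).trace = ((∑ a, ∑ b, ‖A a b‖ ^ 2 : ℝ) : ℂ) := by
      rw [Finset.sum_comm]
      simp [Matrix.trace, Matrix.mul_apply, Complex.conj_mul']
    refine Complex.ofReal_injective ?_
    rw [← h2, h, Complex.ofReal_sum]
    rfl
  rw [← htr]
  refine (sq_sum_le_card_mul_sum_sq).trans (le_of_eq ?_)
  rw [Finset.card_univ]
  congr 1
  refine Finset.sum_congr rfl fun i _ => Real.sq_sqrt ?_
  exact hpsd.eigenvalues_nonneg i

theorem traceNorm_nonneg {d : Type} [Fintype d] [DecidableEq d] (A : Matrix d d ℂ) :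
    0 ≤ traceNorm A :=
  Finset.sum_nonneg fun _ _ => Real.sqrt_nonneg _

/-- Restriction to a set of qubits and its complement. -/
def mergeEquiv {N : ℕ} (S : Finset (Fin N)) :
    Basis {k // k ∈ S} × Basis {k // k ∉ S} ≃ Basis (Fin N) where
  toFun q := merge S q.1 q.2
  invFun i := (fun k => i k, fun k => i k)
  left_inv q := by
    ext k
    · simp [merge, k.2]
    · simp [merge, k.2]
  right_inv i := by
    ext k
    simp [merge]

theorem sum_merge {N : ℕ} (S : Finset (Fin N)) {M : Type*} [AddCommMonoid M]
    (f : Basis (Fin N) → M) : ∑ a, ∑ c, f (merge S a c) = ∑ i, f i := by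
  rw [← (mergeEquiv S).sum_comp, Fintype.sum_prod_type]
  rfl

/-- The matrix element `(a, b)` of the partial trace of `|q_j⟩⟨q_k|`, where the `q_j` are the
columns of `Q`. -/
def reducedTransition {N : ℕ} (S : Finset (Fin N)) (Q : Matrix (Basis (Fin N)) (Basis (Fin N)) ℂ)
    (j k : Basis (Fin N)) (a b : Basis {k // k ∈ S}) : ℂ :=
  ∑ c, Q (merge S a c) j * star (Q (merge S b c) k)

theorem merge_right_injective {N : ℕ} (S : Finset (Fin N)) (b : Basis {k // k ∈ S}) :
    Function.Injective (merge S b) := fun c c' h => by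
  have := (mergeEquiv S).injective (a₁ := (b, c)) (a₂ := (b, c')) h
  simpa using this

section
variable {N : ℕ} (S : Finset (Fin N)) {Q : Matrix (Basis (Fin N)) (Basis (Fin N)) ℂ}

/-- Parseval: the rows of `Q` are orthonormal, so summing over `k` leaves only `c = c'`. -/
theorem sum_norm_sq_reducedTransition (hQ : Q * Qᴴ = 1) (j : Basis (Fin N))
    (a b : Basis {k // k ∈ S}) :
    ∑ k, ‖reducedTransition S Q j k a b‖ ^ 2 = ∑ c, ‖Q (merge S a c) j‖ ^ 2 := by
  have hrow : ∀ c c', ∑ k, star (Q (merge S b c) k) * Q (merge S b c') k =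
      if c' = c then 1 else 0 := by
    intro c c'
    have h := congrFun (congrFun hQ (merge S b c')) (merge S b c)
    rw [Matrix.mul_apply, Matrix.one_apply] at h
    refine Eq.trans (Finset.sum_congr rfl fun k _ => ?_) (h.trans ?_)
    · rw [conjTranspose_apply, mul_comm]
    · by_cases hc : c' = c
      · rw [hc, if_pos rfl, if_pos rfl]
      · rw [if_neg hc, if_neg fun h => hc (merge_right_injective S b h)]
  have h : ((∑ k, ‖reducedTransition S Q j k a b‖ ^ 2 : ℝ) : ℂ) =
      ((∑ c, ‖Q (merge S a c) j‖ ^ 2 : ℝ) : ℂ) := by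
    push_cast
    simp only [← Complex.mul_conj', reducedTransition, map_sum, map_mul, Finset.sum_mul_sum]
    rw [Finset.sum_comm]
    refine Finset.sum_congr rfl fun c _ => ?_
    rw [Finset.sum_comm]
    have : ∀ c', ∑ k, Q (merge S a c) j * star (Q (merge S b c) k) *
        ((starRingEnd ℂ) (Q (merge S a c') j) * (starRingEnd ℂ) (star (Q (merge S b c') k))) =
        if c' = c then Q (merge S a c) j * (starRingEnd ℂ) (Q (merge S a c') j) else 0 := by
      intro c'
      have h2 := congrArg (fun y => Q (merge S a c) j * (starRingEnd ℂ) (Q (merge S a c') j) * y)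
        (hrow c c')
      simp only [mul_ite, mul_one, mul_zero, Finset.mul_sum] at h2
      rw [← h2]
      refine Finset.sum_congr rfl fun k _ => ?_
      rw [Complex.star_def, Complex.conj_conj]
      ring
    rw [Finset.sum_congr rfl fun c' _ => this c']
    simp
  exact_mod_cast h

theorem sum_norm_sq_col (hQ' : Qᴴ * Q = 1) (j : Basis (Fin N)) : ∑ i, ‖Q i j‖ ^ 2 = 1 := by
  have h := congrFun (congrFun hQ' j) j
  rw [Matrix.mul_apply, Matrix.one_apply_eq] at h
  have h2 : ((∑ i, ‖Q i j‖ ^ 2 : ℝ) : ℂ) = 1 := by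
    rw [← h]
    push_cast
    exact Finset.sum_congr rfl fun i _ => by
      rw [conjTranspose_apply, Complex.star_def, Complex.conj_mul']
  exact_mod_cast h2

theorem norm_reducedTransition_le_one (hQ : Q * Qᴴ = 1) (hQ' : Qᴴ * Q = 1) (j k : Basis (Fin N))
    (a b : Basis {k // k ∈ S}) : ‖reducedTransition S Q j k a b‖ ≤ 1 := by
  rw [← sq_le_one_iff₀ (norm_nonneg _)]
  calc ‖reducedTransition S Q j k a b‖ ^ 2 ≤ ∑ k, ‖reducedTransition S Q j k a b‖ ^ 2 :=
        Finset.single_le_sum (f := fun k => ‖reducedTransition S Q j k a b‖ ^ 2)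
          (fun _ _ => by positivity) (Finset.mem_univ k)
    _ = ∑ c, ‖Q (merge S a c) j‖ ^ 2 := sum_norm_sq_reducedTransition S hQ j a b
    _ ≤ ∑ a, ∑ c, ‖Q (merge S a c) j‖ ^ 2 :=
        Finset.single_le_sum (f := fun a => ∑ c, ‖Q (merge S a c) j‖ ^ 2)
          (fun _ _ => by positivity) (Finset.mem_univ a)
    _ = 1 := by rw [sum_merge S fun i => ‖Q i j‖ ^ 2, sum_norm_sq_col hQ']

theorem norm_reducedTransition_comm (j k : Basis (Fin N)) (a b : Basis {k // k ∈ S}) :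
    ‖reducedTransition S Q j k a b‖ = ‖reducedTransition S Q k j b a‖ := by
  rw [← norm_star]
  congr 1
  simp only [reducedTransition, star_sum, star_mul', star_star]
  exact Finset.sum_congr rfl fun c _ => mul_comm _ _

theorem sum_sum_norm_sq_reducedTransition (hQ : Q * Qᴴ = 1) (hQ' : Qᴴ * Q = 1)
    (j : Basis (Fin N)) : ∑ k, ∑ a, ∑ b, ‖reducedTransition S Q j k a b‖ ^ 2 = 2 ^ S.card := by
  rw [Finset.sum_comm]
  have : ∀ a : Basis {k // k ∈ S}, ∑ k, ∑ b, ‖reducedTransition S Q j k a b‖ ^ 2 =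
      2 ^ S.card * ∑ c, ‖Q (merge S a c) j‖ ^ 2 := by
    intro a
    rw [Finset.sum_comm]
    simp only [sum_norm_sq_reducedTransition S hQ]
    simp
  simp only [this]
  rw [← Finset.mul_sum, sum_merge S fun i => ‖Q i j‖ ^ 2, sum_norm_sq_col hQ', mul_one]

/-- Schur test: the kernel is symmetric and nonnegative with all row sums `2 ^ S.card`, and `w j * w
k ≤ (w j ^ 2 + w k ^ 2) / 2`. -/
theorem sum_mul_norm_sq_reducedTransition_le (hQ : Q * Qᴴ = 1) (hQ' : Qᴴ * Q = 1)
    {w : Basis (Fin N) → ℝ} :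
    ∑ j, ∑ k, w j * w k * ∑ a, ∑ b, ‖reducedTransition S Q j k a b‖ ^ 2 ≤
      2 ^ S.card * ∑ j, w j ^ 2 := by
  set G : Basis (Fin N) → Basis (Fin N) → ℝ :=
    fun j k => ∑ a, ∑ b, ‖reducedTransition S Q j k a b‖ ^ 2 with hG
  have hG0 : ∀ j k, 0 ≤ G j k := fun j k => by positivity
  have hsymm : ∀ j k, G j k = G k j := fun j k => by
    simp only [hG]
    rw [Finset.sum_comm]
    refine Finset.sum_congr rfl fun a _ => Finset.sum_congr rfl fun b _ => ?_
    rw [norm_reducedTransition_comm]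
  have hsum : ∀ j, ∑ k, G j k = 2 ^ S.card := sum_sum_norm_sq_reducedTransition S hQ hQ'
  have hsum' : ∀ k, ∑ j, G j k = 2 ^ S.card := fun k => by simp only [fun j => hsymm j k, hsum]
  calc ∑ j, ∑ k, w j * w k * G j k
      ≤ ∑ j, ∑ k, (w j ^ 2 / 2 * G j k + w k ^ 2 / 2 * G j k) := by
        refine Finset.sum_le_sum fun j _ => Finset.sum_le_sum fun k _ => ?_
        nlinarith [mul_nonneg (hG0 j k) (sq_nonneg (w j - w k))]
    _ = ∑ j, w j ^ 2 / 2 * ∑ k, G j k + ∑ k, w k ^ 2 / 2 * ∑ j, G j k := by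
        simp only [Finset.sum_add_distrib, Finset.mul_sum]
        congr 1
        rw [Finset.sum_comm]
    _ = 2 ^ S.card * ∑ j, w j ^ 2 := by
        simp only [hsum, hsum', Finset.mul_sum]
        rw [← Finset.sum_add_distrib]
        exact Finset.sum_congr rfl fun j _ => by ring

end

end Floquet

end

/-! ### Diagonalization, unitarity and equilibration -/

section

open Topology Matrix

theorem HasGenericProducts.injective {ι : Type*} {z : ι → ℂ} (h : HasGenericProducts z) :
    Function.Injective z := by
  intro a b hab
  rcases h a a b b (by rw [hab]) with h | h <;> exact h.1

/-- A unitary matrix with simple spectrum is unitarily diagonalizable. -/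
theorem Matrix.exists_unitary_diagonalization {ι : Type*} [Fintype ι] [DecidableEq ι]
    {U : Matrix ι ι ℂ} (hU : Uᴴ * U = 1) {z : ι → ℂ} (hz : Function.Injective z)
    (hchar : U.charpoly = ∏ i, (Polynomial.X - Polynomial.C (z i))) :
    (∀ i, ‖z i‖ = 1) ∧ ∃ P : Matrix ι ι ℂ, Pᴴ * P = 1 ∧ U * P = P * Matrix.diagonal z := by
  have hex : ∀ i, ∃ v : ι → ℂ, star v ⬝ᵥ v = 1 ∧ U *ᵥ v = z i • v := by
    intro i
    have hroot : U.charpoly.eval (z i) = 0 := by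
      rw [hchar, Polynomial.eval_prod]
      exact Finset.prod_eq_zero (Finset.mem_univ i) (by simp)
    rw [Matrix.eval_charpoly, ← Matrix.exists_mulVec_eq_zero_iff] at hroot
    obtain ⟨v, hv0, hv⟩ := hroot
    rw [Matrix.sub_mulVec, Matrix.scalar_apply, ← Matrix.smul_one_eq_diagonal, Matrix.smul_mulVec,
      Matrix.one_mulVec, sub_eq_zero] at hv
    have hn : star v ⬝ᵥ v = ((∑ a, ‖v a‖ ^ 2 : ℝ) : ℂ) := by
      simp [dotProduct, Complex.conj_mul']
    have hpos : 0 < ∑ a, ‖v a‖ ^ 2 := by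
      obtain ⟨a, ha⟩ := Function.ne_iff.1 hv0
      exact Finset.sum_pos' (fun _ _ => by positivity)
        ⟨a, Finset.mem_univ a, by have := norm_pos_iff.2 ha; positivity⟩
    refine ⟨(((√(∑ a, ‖v a‖ ^ 2))⁻¹ : ℝ) : ℂ) • v, ?_, ?_⟩
    · rw [star_smul, smul_dotProduct, dotProduct_smul, hn, Complex.star_def, Complex.conj_ofReal,
        smul_eq_mul, smul_eq_mul, ← mul_assoc, ← Complex.ofReal_mul, ← Complex.ofReal_mul,
        ← mul_inv, Real.mul_self_sqrt hpos.le, inv_mul_cancel₀ hpos.ne', Complex.ofReal_one]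
    · rw [Matrix.mulVec_smul, ← hv, smul_comm]
  choose v hvv hv using hex
  -- Since `U` preserves inner products, this one identity gives both `‖z i‖ = 1` and the
  -- orthogonality of eigenvectors with distinct eigenvalues.
  have hinner : ∀ i j, star (z i) * z j * (star (v i) ⬝ᵥ v j) = star (v i) ⬝ᵥ v j := by
    intro i j
    have h1 : star (U *ᵥ v i) ⬝ᵥ (U *ᵥ v j) = star (v i) ⬝ᵥ v j := by
      rw [star_mulVec, dotProduct_mulVec, vecMul_vecMul, hU, vecMul_one]
    rw [hv, hv, star_smul, smul_dotProduct, dotProduct_smul, smul_eq_mul, smul_eq_mul,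
      ← mul_assoc] at h1
    exact h1
  have hnorm : ∀ i, star (z i) * z i = 1 := fun i => by
    have := hinner i i
    rwa [hvv, mul_one] at this
  refine ⟨fun i => ?_, Matrix.of fun a i => v i a, ?_, ?_⟩
  · have h := hnorm i
    rw [Complex.star_def, Complex.conj_mul'] at h
    have h2 : ‖z i‖ ^ 2 = 1 := by exact_mod_cast h
    exact (pow_eq_one_iff_of_nonneg (norm_nonneg _) two_ne_zero).1 h2
  · ext i j
    change star (v i) ⬝ᵥ v j = _
    by_cases hij : i = j
    · rw [hij, hvv, Matrix.one_apply_eq]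
    · rw [Matrix.one_apply_ne hij]
      have h1 : (star (z i) * z j - 1) * (star (v i) ⬝ᵥ v j) = 0 := by
        rw [sub_mul, hinner, one_mul, sub_self]
      refine (mul_eq_zero.1 h1).resolve_left fun h2 => hij (hz ?_)
      have h3 := hnorm i
      have hz0 : star (z i) ≠ 0 := left_ne_zero_of_mul_eq_one h3
      exact mul_left_cancel₀ hz0 (by rw [h3, sub_eq_zero.1 h2])
  · ext a i
    rw [Matrix.mul_diagonal]
    have := congrFun (hv i) a
    rw [Pi.smul_apply, smul_eq_mul, mul_comm] at this
    exact this

namespace Floquet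

theorem onSite_mulVec {N : ℕ} (l : Fin N) (M : Matrix (Fin 2) (Fin 2) ℂ) (ψ : Basis (Fin N) → ℂ)
    (a : Basis (Fin N)) :
    (onSite l M *ᵥ ψ) a = ∑ s, M (a l) s * ψ (Function.update a l s) := by
  simp only [mulVec, dotProduct, onSite, of_apply, ite_mul, zero_mul]
  rw [← Finset.sum_filter]
  refine Finset.sum_nbij' (fun b => b l) (fun s => Function.update a l s) (fun _ _ => Finset.mem_univ _)
    (fun s _ => ?_) (fun b hb => ?_) (fun s _ => ?_) (fun b hb => ?_)
  · simp only [Finset.mem_filter, Finset.mem_univ, true_and]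
    exact fun k hk => (Function.update_of_ne hk _ _).symm
  all_goals try
    have hb' : Function.update a l (b l) = b := by
      simp only [Finset.mem_filter, Finset.mem_univ, true_and] at hb
      ext k
      by_cases hk : k = l
      · subst hk; simp
      · rw [Function.update_of_ne hk, hb k hk]
  · exact hb'
  · simp
  · rw [hb']

theorem onSite_commute {N : ℕ} {l l' : Fin N} (hl : l ≠ l') (M M' : Matrix (Fin 2) (Fin 2) ℂ) :
    onSite l M * onSite l' M' = onSite l' M' * onSite l M := by
  refine Matrix.mulVec_injective (funext fun ψ => funext fun a => ?_)
  rw [← mulVec_mulVec, ← mulVec_mulVec, onSite_mulVec, onSite_mulVec]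
  simp only [onSite_mulVec, Finset.mul_sum]
  rw [Finset.sum_comm]
  refine Finset.sum_congr rfl fun s _ => Finset.sum_congr rfl fun t _ => ?_
  rw [Function.update_of_ne hl.symm, Function.update_of_ne hl, Function.update_comm hl]
  ring

theorem sigma_isHermitian {N : ℕ} (l : Fin N) (u : Axis) : (sigma l u).IsHermitian := by
  ext a b
  have hp : ∀ s t, star (pauli u s t) = pauli u t s := by
    intro s t
    cases u <;> fin_cases s <;> fin_cases t <;> simp [pauli]
  simp only [sigma, onSite, conjTranspose_apply, of_apply]
  by_cases h : ∀ k, k ≠ l → a k = b k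
  · rw [if_pos h, if_pos fun k hk => (h k hk).symm, hp]
  · rw [if_neg h, if_neg fun h' => h fun k hk => (h' k hk).symm, star_zero]

theorem Ensemble.pieceHamiltonian_isHermitian (E : Ensemble) {N : ℕ} (p : Param E.n N)
    (j : Fin E.n) : (E.pieceHamiltonian p j).IsHermitian := by
  have hreal : ∀ (r : ℝ) (b : Bool), star (if b = true then (r : ℂ) else 0) =
      if b = true then (r : ℂ) else 0 := fun r b => by
    split_ifs <;> simp
  rw [pieceHamiltonian, Matrix.IsHermitian, conjTranspose_add, conjTranspose_sum, conjTranspose_sum]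
  simp only [conjTranspose_sum, conjTranspose_smul, conjTranspose_mul, (sigma_isHermitian _ _).eq,
    hreal]
  congr 1
  refine Finset.sum_congr rfl fun l _ => Finset.sum_congr rfl fun u _ =>
    Finset.sum_congr rfl fun u' _ => ?_
  rw [sigma, sigma, onSite_commute]
  simp [bondLeft, bondRight]

theorem Ensemble.exp_mem_unitary (E : Ensemble) {N : ℕ} (p : Param E.n N) (j : Fin E.n) (τ : ℝ) :
    NormedSpace.exp ((-Complex.I * (τ : ℂ)) • E.pieceHamiltonian p j) ∈
      Matrix.unitaryGroup (Basis (Fin N)) ℂ := by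
  set A := (-Complex.I * (τ : ℂ)) • E.pieceHamiltonian p j with hA
  have h1 : Aᴴ = -A := by
    rw [hA, conjTranspose_smul, (E.pieceHamiltonian_isHermitian p j).eq, ← neg_smul]
    simp
  rw [Matrix.mem_unitaryGroup_iff, Matrix.star_eq_conjTranspose, ← Matrix.exp_conjTranspose, h1,
    ← Matrix.exp_add_of_commute _ _ (Commute.refl A).neg_right, add_neg_cancel,
    NormedSpace.exp_zero]

theorem Ensemble.evolutionWithin_mem_unitary (E : Ensemble) {N : ℕ} (p : Param E.n N) (x : ℝ) :
    E.evolutionWithin p x ∈ Matrix.unitaryGroup (Basis (Fin N)) ℂ := by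
  refine Submonoid.list_prod_mem _ fun M hM => ?_
  rw [List.mem_reverse, List.mem_ofFn] at hM
  obtain ⟨j, rfl⟩ := hM
  exact E.exp_mem_unitary p j _

theorem Ensemble.continuous_evolutionWithin (E : Ensemble) {N : ℕ} (p : Param E.n N) :
    Continuous fun x : ℝ => E.evolutionWithin p x := by
  simp only [evolutionWithin, List.ofFn_eq_map, ← List.map_reverse]
  refine continuous_list_prod _ fun j _ => (Matrix.continuous_exp _).comp ?_
  unfold duration
  fun_prop

theorem Ensemble.state_add (E : Ensemble) {N : ℕ} (p : Param E.n N) (ψ : Basis (Fin N) → ℂ)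
    (m : ℕ) {x : ℝ} (hx : x ∈ Set.Ico (0 : ℝ) 1) :
    E.state p ψ (m + x) = (E.evolutionWithin p x * E.floquetOperator p ^ m) *ᵥ ψ := by
  have h1 : Int.fract ((m : ℝ) + x) = x := by
    rw [Int.fract_natCast_add, Int.fract_eq_self.2 hx]
  have h2 : ⌊(m : ℝ) + x⌋₊ = m := by
    rw [add_comm, Nat.floor_add_natCast hx.1, Nat.floor_eq_zero.2 hx.2, zero_add]
  rw [state, evolution, h1, h2]

section
variable {N : ℕ} (S : Finset (Fin N)) (Q : Matrix (Basis (Fin N)) (Basis (Fin N)) ℂ)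
  (c : Basis (Fin N) → ℂ)

theorem reducedDensity_mulVec (a b : Basis {k // k ∈ S}) :
    reducedDensity S (Q *ᵥ c) a b = ∑ j, ∑ k, c j * star (c k) * reducedTransition S Q j k a b := by
  simp only [reducedDensity, partialTrace, of_apply, vecMulVec_apply, Pi.star_apply, mulVec,
    dotProduct, star_sum, star_mul', Finset.sum_mul_sum, reducedTransition]
  simp only [Finset.mul_sum]
  rw [Finset.sum_comm]
  refine Finset.sum_congr rfl fun j _ => ?_
  rw [Finset.sum_comm]
  refine Finset.sum_congr rfl fun k _ => Finset.sum_congr rfl fun d _ => ?_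
  ring

/-- A square root of the reduced density matrix of the dephased state, whose weights in the
orthonormal basis of the columns of `Q` are the `|c_j|²`. -/
def dephasedRoot : Matrix (Basis {k // k ∈ S}) (Basis {k // k ∉ S} × Basis (Fin N)) ℂ :=
  Matrix.of fun a q => Q (merge S a q.1) q.2 * c q.2

/-- The reduced density matrix of the dephased state. -/
def dephasedDensity : Matrix (Basis {k // k ∈ S}) (Basis {k // k ∈ S}) ℂ :=
  dephasedRoot S Q c * (dephasedRoot S Q c)ᴴ

theorem dephasedDensity_apply (a b : Basis {k // k ∈ S}) :
    dephasedDensity S Q c a b = ∑ j, c j * star (c j) * reducedTransition S Q j j a b := by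
  simp only [dephasedDensity, Matrix.mul_apply, dephasedRoot, conjTranspose_apply, of_apply,
    star_mul', Fintype.sum_prod_type, reducedTransition, Finset.mul_sum]
  rw [Finset.sum_comm]
  exact Finset.sum_congr rfl fun j _ => Finset.sum_congr rfl fun d _ => by ring

variable {Q c}

theorem dephasedDensity_isDensity (hQ' : Qᴴ * Q = 1) (hc : ∑ j, ‖c j‖ ^ 2 = 1) :
    IsDensity (dephasedDensity S Q c) := by
  refine ⟨Matrix.posSemidef_self_mul_conjTranspose _, ?_⟩
  have h1 : ∀ j, ∑ a, reducedTransition S Q j j a a = 1 := fun j => by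
    simp only [reducedTransition]
    rw [sum_merge S fun i => Q i j * star (Q i j)]
    have := sum_norm_sq_col hQ' j
    simp only [Complex.star_def, Complex.mul_conj']
    exact_mod_cast this
  simp only [Matrix.trace, Matrix.diag, dephasedDensity_apply]
  rw [Finset.sum_comm]
  simp only [← Finset.mul_sum, h1, mul_one, Complex.star_def, Complex.mul_conj']
  exact_mod_cast hc

/-- Equilibration: on average over the periods, the reduced density matrix is close to that of the
dephased state, in terms of the participation ratio `∑ |c_j|⁴` of the initial state. -/
theorem exists_sum_traceNorm_le {z : Basis (Fin N) → ℂ} (hz : HasGenericProducts z)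
    (hz1 : ∀ i, ‖z i‖ = 1) :
    ∃ C : ℝ, 0 ≤ C ∧ ∀ (Q : Matrix (Basis (Fin N)) (Basis (Fin N)) ℂ) (c : Basis (Fin N) → ℂ),
      Q * Qᴴ = 1 → Qᴴ * Q = 1 → ∑ j, ‖c j‖ ^ 2 = 1 → ∀ M : ℕ,
        ∑ m ∈ Finset.range M, traceNorm (reducedDensity S (Q *ᵥ fun j => z j ^ m * c j) -
          dephasedDensity S Q c) ≤ √(M * (M * (4 ^ S.card * ∑ j, ‖c j‖ ^ 4) + C)) := by
  let κ := {q : Basis (Fin N) × Basis (Fin N) // q.1 ≠ q.2}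
  let ζ : κ → ℂ := fun q => z q.1.1 * star (z q.1.2)
  have hstar : ∀ i, z i * star (z i) = 1 := fun i => by
    rw [Complex.star_def, Complex.mul_conj', hz1]; simp
  have hζ : ∀ q, ‖ζ q‖ = 1 := fun q => by simp [ζ, hz1]
  -- A coincidence of frequencies becomes one of products by cross-multiplication; the exchanged
  -- alternative would force `j = k`, which is excluded.
  have hinj : Function.Injective ζ := by
    rintro ⟨⟨j, k⟩, hjk⟩ ⟨⟨l, m⟩, hlm⟩ h
    simp only [ζ] at h hjk hlm
    have h1 : z j * z m = z l * z k := by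
      calc z j * z m = z j * star (z k) * (z k * z m) := by
            rw [show z j * star (z k) * (z k * z m) = z j * z m * (z k * star (z k)) by ring,
              hstar, mul_one]
        _ = z l * z k * (z m * star (z m)) := by rw [h]; ring
        _ = z l * z k := by rw [hstar, mul_one]
    rcases hz _ _ _ _ h1 with ⟨rfl, rfl⟩ | ⟨rfl, -⟩
    · rfl
    · exact (hjk rfl).elim
  obtain ⟨C, hC0, hC⟩ := exists_sum_norm_sq_le hζ hinj
  -- One factor comes from the trace norm bound and two from the number of entries. The constant
  -- must not depend on `Q` or `c`, because `Q` will vary with the time within the period.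
  refine ⟨2 ^ S.card * (2 ^ S.card * (2 ^ S.card * C)), by positivity, fun Q c hQ hQ' hc M => ?_⟩
  have hc1 : ∀ j, ‖c j‖ ≤ 1 := fun j => by
    rw [← sq_le_one_iff₀ (norm_nonneg _), ← hc]
    exact Finset.single_le_sum (f := fun j => ‖c j‖ ^ 2) (fun _ _ => by positivity)
      (Finset.mem_univ j)
  let X : Basis {k // k ∈ S} → Basis {k // k ∈ S} → κ → ℂ := fun a b q =>
    c q.1.1 * star (c q.1.2) * reducedTransition S Q q.1.1 q.1.2 a b
  have hX : ∀ a b q, ‖X a b q‖ ≤ 1 := fun a b q => by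
    simp only [X, norm_mul, norm_star]
    exact mul_le_one₀ (mul_le_one₀ (hc1 _) (norm_nonneg _) (hc1 _)) (norm_nonneg _)
      (norm_reducedTransition_le_one S hQ hQ' _ _ _ _)
  set Δ : ℕ → Matrix (Basis {k // k ∈ S}) (Basis {k // k ∈ S}) ℂ := fun m =>
    reducedDensity S (Q *ᵥ fun j => z j ^ m * c j) - dephasedDensity S Q c with hΔ
  have hdiff : ∀ m a b, Δ m a b = ∑ q, X a b q * ζ q ^ m := by
    intro m a b
    have hfull : ∑ q : Basis (Fin N) × Basis (Fin N), (z q.1 ^ m * c q.1) *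
        star (z q.2 ^ m * c q.2) * reducedTransition S Q q.1 q.2 a b =
        ∑ q ∈ Finset.univ.filter (fun q : Basis (Fin N) × Basis (Fin N) => q.1 = q.2),
          (z q.1 ^ m * c q.1) * star (z q.2 ^ m * c q.2) * reducedTransition S Q q.1 q.2 a b +
        ∑ q : κ, X a b q * ζ q ^ m := by
      rw [← Finset.sum_filter_add_sum_filter_not Finset.univ
        (fun q : Basis (Fin N) × Basis (Fin N) => q.1 = q.2)]
      congr 1
      rw [Finset.sum_subtype (p := fun q : Basis (Fin N) × Basis (Fin N) => q.1 ≠ q.2) _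
        (fun q => by simp)]
      refine Finset.sum_congr rfl fun q _ => ?_
      simp only [X, ζ, star_mul', star_pow, mul_pow]
      ring
    have hdiag : ∑ q ∈ Finset.univ.filter (fun q : Basis (Fin N) × Basis (Fin N) => q.1 = q.2),
          (z q.1 ^ m * c q.1) * star (z q.2 ^ m * c q.2) * reducedTransition S Q q.1 q.2 a b =
        dephasedDensity S Q c a b := by
      rw [dephasedDensity_apply, Finset.sum_filter, Fintype.sum_prod_type]
      refine Finset.sum_congr rfl fun j _ => ?_
      rw [Finset.sum_ite_eq Finset.univ j]
      simp only [Finset.mem_univ, if_true]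
      have : z j ^ m * star (z j) ^ m = 1 := by rw [← mul_pow, hstar, one_pow]
      rw [star_mul', star_pow]
      linear_combination (c j * star (c j) * reducedTransition S Q j j a b) * this
    simp only [hΔ]
    rw [Matrix.sub_apply, reducedDensity_mulVec, ← Fintype.sum_prod_type', hfull, hdiag]
    ring
  -- the second moments
  have hsq : ∑ m ∈ Finset.range M, traceNorm (Δ m) ^ 2 ≤
      M * (4 ^ S.card * ∑ j, ‖c j‖ ^ 4) + 2 ^ S.card * (2 ^ S.card * (2 ^ S.card * C)) := by
    have hcard : (Fintype.card (Basis {k // k ∈ S}) : ℝ) = 2 ^ S.card := by simp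
    -- Restoring the nonnegative diagonal terms brings the sum under the Schur test with weights `‖c
    -- j‖ ^ 2`.
    have hXsum : ∑ a, ∑ b, ∑ q, ‖X a b q‖ ^ 2 ≤ 2 ^ S.card * ∑ j, ‖c j‖ ^ 4 := by
      have h1 := sum_mul_norm_sq_reducedTransition_le S hQ hQ' (w := fun j => ‖c j‖ ^ 2)
      simp only [← pow_mul] at h1
      refine le_trans ?_ h1
      rw [← Fintype.sum_prod_type' (f := fun j k => ‖c j‖ ^ 2 * ‖c k‖ ^ 2 *
        ∑ a, ∑ b, ‖reducedTransition S Q j k a b‖ ^ 2)]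
      simp only [Finset.mul_sum]
      rw [Finset.sum_comm (s := (Finset.univ : Finset (Basis (Fin N) × Basis (Fin N))))]
      refine Finset.sum_le_sum fun a _ => ?_
      rw [Finset.sum_comm (s := (Finset.univ : Finset (Basis (Fin N) × Basis (Fin N))))]
      refine Finset.sum_le_sum fun b _ => ?_
      have h2 : ∑ q : κ, ‖X a b q‖ ^ 2 =
          ∑ q ∈ Finset.univ.filter (fun q : Basis (Fin N) × Basis (Fin N) => q.1 ≠ q.2),
            ‖c q.1‖ ^ 2 * ‖c q.2‖ ^ 2 * ‖reducedTransition S Q q.1 q.2 a b‖ ^ 2 := by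
        rw [Finset.sum_subtype (p := fun q : Basis (Fin N) × Basis (Fin N) => q.1 ≠ q.2) _
          (fun q => by simp)]
        refine Finset.sum_congr rfl fun q _ => ?_
        simp only [X, norm_mul, norm_star, mul_pow]
      rw [h2]
      exact Finset.sum_le_sum_of_subset_of_nonneg (Finset.filter_subset _ _)
        fun _ _ _ => by positivity
    calc ∑ m ∈ Finset.range M, traceNorm (Δ m) ^ 2
        ≤ ∑ m ∈ Finset.range M, 2 ^ S.card * ∑ a, ∑ b, ‖Δ m a b‖ ^ 2 :=
          Finset.sum_le_sum fun m _ => by rw [← hcard]; exact traceNorm_sq_le _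
      _ = 2 ^ S.card * ∑ a, ∑ b, ∑ m ∈ Finset.range M, ‖∑ q, X a b q * ζ q ^ m‖ ^ 2 := by
          rw [← Finset.mul_sum, Finset.sum_comm]
          simp only [hdiff]
          congr 1
          exact Finset.sum_congr rfl fun a _ => Finset.sum_comm
      _ ≤ 2 ^ S.card * ∑ a : Basis {k // k ∈ S}, ∑ b : Basis {k // k ∈ S},
            (M * ∑ q, ‖X a b q‖ ^ 2 + C) := by
          gcongr with a _ b _
          exact hC (X a b) (hX a b) M
      _ = 2 ^ S.card * (M * ∑ a, ∑ b, ∑ q, ‖X a b q‖ ^ 2) +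
            2 ^ S.card * (2 ^ S.card * (2 ^ S.card * C)) := by
          simp only [Finset.sum_add_distrib, ← Finset.mul_sum, Finset.sum_const, Finset.card_univ,
            nsmul_eq_mul, hcard]
          ring
      _ ≤ 2 ^ S.card * (M * (2 ^ S.card * ∑ j, ‖c j‖ ^ 4)) +
            2 ^ S.card * (2 ^ S.card * (2 ^ S.card * C)) := by gcongr
      _ = _ := by
          rw [show (4 : ℝ) = 2 * 2 by norm_num, mul_pow]
          ring
  refine Real.le_sqrt_of_sq_le ?_
  calc (∑ m ∈ Finset.range M, traceNorm (Δ m)) ^ 2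
      ≤ (Finset.range M).card * ∑ m ∈ Finset.range M, traceNorm (Δ m) ^ 2 :=
        sq_sum_le_card_mul_sum_sq
    _ ≤ _ := by rw [Finset.card_range]; gcongr

end

end Floquet

end

/-! ### From averages to approximate periodicity -/

section

open Topology Matrix

/-- Superadditivity of the lower integral holds for arbitrary functions, so measurability of the
trace norm along the evolution is never needed. -/
theorem MeasureTheory.sum_lintegral_le {α κ : Type*} [MeasurableSpace α] {μ : Measure α}
    (s : Finset κ) (f : κ → α → ENNReal) :
    ∑ k ∈ s, ∫⁻ x, f k x ∂μ ≤ ∫⁻ x, ∑ k ∈ s, f k x ∂μ := by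
  classical
  induction s using Finset.induction_on with
  | empty => simp
  | insert k s hk ih =>
    simp only [Finset.sum_insert hk]
    exact (add_le_add_right ih _).trans (le_lintegral_add _ _)

namespace Floquet

/-- A criterion for approximate periodicity: the deviations from a fixed profile are small on
average over the periods. -/
theorem isApproxPeriodic_of_sum_le {d : Type} [Fintype d] [DecidableEq d] {ε A C : ℝ} (hε : 0 < ε)
    (hA : A < ε ^ 4) {f g : ℝ → Matrix d d ℂ} (hg : ∀ a b, Measurable fun x => g x a b)
    (hg' : ∀ x ∈ Set.Ico (0 : ℝ) 1, IsDensity (g x))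
    (h : ∀ x ∈ Set.Ico (0 : ℝ) 1, ∀ M : ℕ,
      ∑ m ∈ Finset.range M, traceNorm (f (m + x) - g x) ≤ √(M * (M * A + C))) :
    IsApproxPeriodic ε f := by
  refine ⟨g, hg, hg', ?_⟩
  -- Markov's inequality: the total deviation over `M` periods is at most `M * ε ^ 2`, and each bad
  -- period contributes more than `ε`, so at most `M * ε` are bad. The square root in the hypothesis
  -- turns `ε ^ 2` into the threshold `ε ^ 4`.
  have hbound : ∀ (M : ℕ) (G : Finset ℕ), M * A + C ≤ M * ε ^ 4 → G ⊆ Finset.range M →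
      (∀ m ∈ Finset.range M, m ∉ G → ENNReal.ofReal ε <
        ∫⁻ x in Set.Ico (0 : ℝ) 1, ENNReal.ofReal (traceNorm (f (m + x) - g x))) →
      (M : ℝ) - M * ε ≤ G.card := by
    intro M G hM hG hbad
    set T := Finset.range M \ G with hT
    have h1 : (T.card : ENNReal) * ENNReal.ofReal ε ≤ ENNReal.ofReal (M * ε ^ 2) := by
      calc (T.card : ENNReal) * ENNReal.ofReal ε = ∑ m ∈ T, ENNReal.ofReal ε := by simp
        _ ≤ ∑ m ∈ T, ∫⁻ x in Set.Ico (0 : ℝ) 1, ENNReal.ofReal (traceNorm (f (m + x) - g x)) :=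
          Finset.sum_le_sum fun m hm => by
            rw [hT, Finset.mem_sdiff] at hm
            exact (hbad m hm.1 hm.2).le
        _ ≤ ∑ m ∈ Finset.range M,
              ∫⁻ x in Set.Ico (0 : ℝ) 1, ENNReal.ofReal (traceNorm (f (m + x) - g x)) :=
          Finset.sum_le_sum_of_subset Finset.sdiff_subset
        _ ≤ ∫⁻ x in Set.Ico (0 : ℝ) 1,
              ∑ m ∈ Finset.range M, ENNReal.ofReal (traceNorm (f (m + x) - g x)) :=
          sum_lintegral_le _ _
        _ ≤ ∫⁻ _ in Set.Ico (0 : ℝ) 1, ENNReal.ofReal (M * ε ^ 2) := by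
          refine setLIntegral_mono measurable_const fun x hx => ?_
          rw [← ENNReal.ofReal_sum_of_nonneg fun _ _ => traceNorm_nonneg _]
          refine ENNReal.ofReal_le_ofReal ((h x hx M).trans (Real.sqrt_le_iff.2 ⟨by positivity, ?_⟩))
          calc (M : ℝ) * (M * A + C) ≤ M * (M * ε ^ 4) := by gcongr
            _ = (M * ε ^ 2) ^ 2 := by ring
        _ = ENNReal.ofReal (M * ε ^ 2) := by simp
    have h2 : (T.card : ℝ) * ε ≤ M * ε ^ 2 := by
      rw [← ENNReal.ofReal_natCast, ← ENNReal.ofReal_mul (by positivity)] at h1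
      exact (ENNReal.ofReal_le_ofReal_iff (by positivity)).1 h1
    have h3 : (T.card : ℝ) ≤ M * ε := by
      refine le_of_mul_le_mul_right ?_ hε
      linarith [h2, show (M : ℝ) * ε * ε = M * ε ^ 2 by ring]
    have h4 : (T.card : ℝ) + G.card = M := by
      exact_mod_cast (Finset.card_sdiff_add_card_eq_card hG).trans (Finset.card_range M)
    linarith
  refine le_liminf_of_le ?_ ?_
  · refine IsBoundedUnder.isCoboundedUnder_ge (isBoundedUnder_of ⟨1, fun M => ?_⟩)
    refine div_le_one_of_le₀ ?_ (by positivity)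
    exact Nat.cast_le.2 ((Finset.card_le_card (@Finset.filter_subset _ _ _ _)).trans
      (Finset.card_range M).le)
  -- Beyond this many periods the strict gap `A < ε ^ 4` absorbs the constant `C`.
  · obtain ⟨M₀, hM₀⟩ := exists_nat_ge (C / (ε ^ 4 - A))
    filter_upwards [eventually_ge_atTop (M₀ + 1)] with M hM
    have hMpos : (0 : ℝ) < M := by exact_mod_cast (Nat.succ_pos M₀).trans_le hM
    have hMM : (M₀ : ℝ) ≤ M := by exact_mod_cast (Nat.le_succ M₀).trans hM
    have h1 : C ≤ M * (ε ^ 4 - A) := by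
      rw [div_le_iff₀ (sub_pos.2 hA)] at hM₀
      exact hM₀.trans (by have := (sub_pos.2 hA).le; gcongr)
    rw [le_div_iff₀ hMpos]
    have h2 := hbound M _ (by linarith) (@Finset.filter_subset _ _ _ _) fun m hm hm' => by
      exact not_le.1 fun hle => hm' ((@Finset.mem_filter _ _ _ _ _).2 ⟨hm, hle⟩)
    linarith

theorem sum_norm_sq_productState {N : ℕ} (φ : Fin N → QubitState) :
    ∑ a, ‖productState φ a‖ ^ 2 = 1 := by
  have h1 : ∀ l, ∑ s, ‖(φ l : EuclideanSpace ℂ (Fin 2)) s‖ ^ 2 = 1 := fun l => by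
    rw [Fin.sum_univ_two]; exact norm_sq_add_norm_sq (φ l)
  have h2 := Finset.prod_univ_sum (fun _ : Fin N => (Finset.univ : Finset (Fin 2)))
    fun l s => ‖(φ l : EuclideanSpace ℂ (Fin 2)) s‖ ^ 2
  simp only [h1, Finset.prod_const_one, Fintype.piFinset_univ] at h2
  rw [h2]
  refine Finset.sum_congr rfl fun a _ => ?_
  rw [productState, norm_prod, Finset.prod_pow]

theorem conjTranspose_mulVec_eq_overlap {N : ℕ} (P : Matrix (Basis (Fin N)) (Basis (Fin N)) ℂ)
    (φ : Fin N → QubitState) (j : Basis (Fin N)) :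
    (Pᴴ *ᵥ productState φ) j = overlap (fun a => star (P a j)) φ := rfl

theorem sum_norm_sq_conjTranspose_mulVec {ι : Type*} [Fintype ι] [DecidableEq ι]
    {P : Matrix ι ι ℂ} (hP : P * Pᴴ = 1) (ψ : ι → ℂ) :
    ∑ j, ‖(Pᴴ *ᵥ ψ) j‖ ^ 2 = ∑ a, ‖ψ a‖ ^ 2 := by
  have hn : ∀ w : ι → ℂ, ((∑ a, ‖w a‖ ^ 2 : ℝ) : ℂ) = star w ⬝ᵥ w := fun w => by
    simp [dotProduct, Complex.conj_mul']
  refine Complex.ofReal_injective ?_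
  rw [hn, hn, star_mulVec, dotProduct_mulVec, vecMul_vecMul, conjTranspose_conjTranspose, hP,
    vecMul_one]

/-- The reduced density matrix of a state with a small participation ratio in the eigenbasis of a
generic Floquet operator is approximately periodic. -/
theorem Ensemble.isApproxPeriodic_of_participation (E : Ensemble) {N : ℕ} (p : Param E.n N)
    (S : Finset (Fin N)) {z : Basis (Fin N) → ℂ} (hz : HasGenericProducts z) (hz1 : ∀ i, ‖z i‖ = 1)
    {P : Matrix (Basis (Fin N)) (Basis (Fin N)) ℂ} (hP : Pᴴ * P = 1)
    (hUP : E.floquetOperator p * P = P * Matrix.diagonal z) {ψ : Basis (Fin N) → ℂ}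
    (hψ : ∑ a, ‖ψ a‖ ^ 2 = 1) {ε : ℝ} (hε : 0 < ε)
    (h : 4 ^ S.card * ∑ j, ‖(Pᴴ *ᵥ ψ) j‖ ^ 4 < ε ^ 4) :
    IsApproxPeriodic ε fun t => reducedDensity S (E.state p ψ t) := by
  have hP' : P * Pᴴ = 1 := mul_eq_one_comm.1 hP
  set c := Pᴴ *ᵥ ψ with hc
  have hc1 : ∑ j, ‖c j‖ ^ 2 = 1 := by rw [hc, sum_norm_sq_conjTranspose_mulVec hP', hψ]
  obtain ⟨C, -, hC⟩ := exists_sum_traceNorm_le S hz hz1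
  -- The evolution within a period is put into the basis, as `Q = U(0, x) * P`; the amplitudes `c`
  -- then depend only on the initial state.
  have hQ : ∀ x, (E.evolutionWithin p x * P)ᴴ * (E.evolutionWithin p x * P) = 1 := fun x => by
    have := Matrix.mem_unitaryGroup_iff'.1 (E.evolutionWithin_mem_unitary p x)
    rw [Matrix.star_eq_conjTranspose] at this
    rw [conjTranspose_mul, Matrix.mul_assoc, ← Matrix.mul_assoc _ _ P, this, Matrix.one_mul, hP]
  refine isApproxPeriodic_of_sum_le (g := fun x => dephasedDensity S (E.evolutionWithin p x * P) c)
    (C := C) hε h (fun a b => ?_) (fun x _ => dephasedDensity_isDensity S (hQ x) hc1)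
    fun x hx M => ?_
  · refine Continuous.measurable ?_
    simp only [dephasedDensity_apply, reducedTransition]
    have hcont : Continuous fun x => E.evolutionWithin p x * P :=
      (E.continuous_evolutionWithin p).matrix_mul continuous_const
    have hentry : ∀ i j, Continuous fun x => (E.evolutionWithin p x * P) i j :=
      fun i j => hcont.matrix_elem i j
    refine continuous_finsetSum _ fun j _ => continuous_const.mul (continuous_finsetSum _ fun d _ => ?_)
    exact (hentry _ _).mul (hentry _ _).star
  · have hpow : ∀ m : ℕ, E.floquetOperator p ^ m * P = P * Matrix.diagonal fun j => z j ^ m := by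
      intro m
      induction m with
      | zero => simp
      | succ m ih =>
        rw [pow_succ', Matrix.mul_assoc, ih, ← Matrix.mul_assoc, hUP, Matrix.mul_assoc,
          Matrix.diagonal_mul_diagonal]
        simp only [pow_succ']
    have hstate : ∀ m : ℕ, E.state p ψ (m + x) =
        (E.evolutionWithin p x * P) *ᵥ fun j => z j ^ m * c j := by
      intro m
      have h1 : ψ = P *ᵥ c := by rw [hc, mulVec_mulVec, hP', one_mulVec]
      rw [E.state_add p ψ m hx]
      conv_lhs => rw [h1]
      rw [mulVec_mulVec, Matrix.mul_assoc, hpow, ← Matrix.mul_assoc, ← mulVec_mulVec]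
      congr 1
      ext j
      rw [mulVec_diagonal]
    simp only [hstate]
    exact hC _ c (mul_eq_one_comm.1 (hQ x)) (hQ x) hc1 M

-- The fraction `1054 / 665` is a convergent of `log₂ 3` from below and still exceeds `1.58496 = 1 +
-- 2 * 0.29248`.
set_option exponentiation.threshold 1100 in
theorem log_two_mul_lt_log_three : 1.58496 * Real.log 2 < Real.log 3 := by
  have h : Real.log ((2 : ℝ) ^ 1054) < Real.log ((3 : ℝ) ^ 665) :=
    Real.log_lt_log (by positivity) (by norm_num)
  rw [Real.log_pow, Real.log_pow] at h
  have := Real.log_pos one_lt_two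
  push_cast at h
  linarith

/-- Haar-random product states have a small participation ratio in any orthonormal basis. -/
theorem haarProduct_participation_ge_le {N : ℕ}
    {P : Matrix (Basis (Fin N)) (Basis (Fin N)) ℂ} (hP : Pᴴ * P = 1) {t : ℝ} (ht : 0 < t) :
    haarProduct N {φ | t ≤ ∑ j, ‖(Pᴴ *ᵥ productState φ) j‖ ^ 4} ≤
      ENNReal.ofReal ((2 / 3) ^ N / t) := by
  have : IsProbabilityMeasure (haarProduct N) := by unfold haarProduct; infer_instance
  simp only [conjTranspose_mulVec_eq_overlap]
  have hcont : ∀ j, Continuous fun φ : Fin N → QubitState =>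
      ‖overlap (fun a => star (P a j)) φ‖ ^ 4 := fun j => by
    have := continuous_overlap fun a => star (P a j)
    fun_prop
  have hint : Integrable (fun φ => ∑ j, ‖overlap (fun a => star (P a j)) φ‖ ^ 4) (haarProduct N) :=
    integrable_haarProduct (continuous_finsetSum _ fun j _ => hcont j)
  have hE : ∫ φ, ∑ j, ‖overlap (fun a => star (P a j)) φ‖ ^ 4 ∂haarProduct N ≤ (2 / 3) ^ N := by
    -- Each of the `2 ^ N` basis vectors contributes at most `(1 / 3) ^ N`.
    rw [integral_finsetSum _ fun j _ => integrable_haarProduct (hcont j)]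
    calc ∑ j, ∫ φ, ‖overlap (fun a => star (P a j)) φ‖ ^ 4 ∂haarProduct N
        ≤ ∑ _j : Basis (Fin N), (1 / 3 : ℝ) ^ N := Finset.sum_le_sum fun j _ => by
          refine (integral_overlap_pow_four_le _).trans (le_of_eq ?_)
          simp only [norm_star, sum_norm_sq_col hP, one_pow, mul_one]
      _ = (2 / 3) ^ N := by
          simp [div_eq_mul_inv, mul_pow]
  have hM := mul_meas_ge_le_integral_of_nonneg (μ := haarProduct N)
    (Eventually.of_forall fun φ => by positivity) hint t
  rw [← ofReal_measureReal]
  refine ENNReal.ofReal_le_ofReal ?_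
  rw [le_div_iff₀ ht, mul_comm]
  exact hM.trans hE

end Floquet

end

/-! ### Balancing the exponents -/

theorem theorem3 :
    ∃ c₁ > (0 : ℝ), ∃ c₂ > (0 : ℝ), ∃ N₀ : ℕ, ∀ N : ℕ, N₀ < N →
      ∀ E : Floquet.Ensemble,
        E.α E.first Floquet.Axis.x = true →
        E.α E.first Floquet.Axis.z = true →
        E.γ E.first Floquet.Axis.z Floquet.Axis.z = true →
      ∀ S : Finset (Fin N), (S.card : ℝ) ≤ 0.29248 * (N : ℝ) →
      ∀ᵐ p : Floquet.Param E.n N,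
        Floquet.haarProduct N
            {φ | ¬ Floquet.IsApproxPeriodic (Real.exp (-c₁ * N)) fun t : ℝ =>
              Floquet.reducedDensity S (E.state p (Floquet.productState φ) t)} ≤
          ENNReal.ofReal (Real.exp (-c₂ * N)) := by
  have ha := sub_pos.2 Floquet.log_two_mul_lt_log_three
  set a := Real.log 3 - 1.58496 * Real.log 2 with ha_def
  -- Here `a` is the exponential slack per qubit in `4 ^ L * (2/3) ^ N`. Markov's threshold spends
  -- half of it on the probability, `exp (-a n / 2)`; the other half is `ε ^ 4` for `ε = exp (-a n /
  -- 8)`.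
  refine ⟨a / 8, by positivity, a / 2, by positivity, 0, fun N hN E hx hz hzz S hS => ?_⟩
  obtain ⟨N, rfl⟩ := Nat.exists_eq_succ_of_ne_zero hN.ne'
  filter_upwards [E.ae_hasGenericProducts hx hz hzz N] with p hp
  obtain ⟨z, hgen, hchar⟩ := hp
  have hU := Matrix.mem_unitaryGroup_iff'.1 (E.evolutionWithin_mem_unitary p 1)
  rw [Matrix.star_eq_conjTranspose] at hU
  obtain ⟨hz1, P, hP, hUP⟩ := Matrix.exists_unitary_diagonalization hU hgen.injective hchar
  set n : ℝ := ((N + 1 : ℕ) : ℝ) with hn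
  have h23 : (2 / 3 : ℝ) ^ (N + 1) = Real.exp (n * (Real.log 2 - Real.log 3)) := by
    rw [← Real.log_div (by norm_num) (by norm_num), hn, Real.exp_nat_mul,
      Real.exp_log (by norm_num)]
  have h4 : (4 : ℝ) ^ S.card ≤ Real.exp (n * (0.58496 * Real.log 2)) := by
    have h1 : (4 : ℝ) ^ S.card = Real.exp (S.card * (2 * Real.log 2)) := by
      rw [Real.exp_nat_mul, two_mul, Real.exp_add, Real.exp_log (by norm_num)]
      norm_num
    rw [h1, Real.exp_le_exp]
    nlinarith [Real.log_pos one_lt_two]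
  refine (measure_mono fun φ hφ => ?_).trans ((Floquet.haarProduct_participation_ge_le hP
    (t := Real.exp (n * (Real.log 2 - Real.log 3 + a / 2))) (Real.exp_pos _)).trans ?_)
  · by_contra hlt
    rw [Set.mem_ofPred_eq, not_le] at hlt
    refine hφ (E.isApproxPeriodic_of_participation p S hgen hz1 hP hUP
      (Floquet.sum_norm_sq_productState φ) (Real.exp_pos _) ?_)
    calc _ < (4 : ℝ) ^ S.card * Real.exp (n * (Real.log 2 - Real.log 3 + a / 2)) := by gcongr
      _ ≤ Real.exp (n * (0.58496 * Real.log 2)) *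
            Real.exp (n * (Real.log 2 - Real.log 3 + a / 2)) := by gcongr
      _ = Real.exp (-(a / 8) * n) ^ 4 := by
          rw [← Real.exp_add, ← Real.exp_nat_mul]
          congr 1
          rw [ha_def]
          push_cast
          ring
  · refine ENNReal.ofReal_le_ofReal (le_of_eq ?_)
    rw [h23, ← Real.exp_sub]
    congr 1
    ring
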